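/- **Preservation for a calculus with ordered resources.** Fix an ordered partial monoid $(\mathbb M,\odot,\varepsilon,\le)$: $\odot$ is a partial binary operation with neutral element $\varepsilon$ (products with $\varepsilon$ are always defined), associative in the sense that both bracketings are defined or undefined together and agree when defined, and $\le$ is a preorder such that $m\le m'$, $n\le n'$ and $m'\odot n'$ defined imply $m\odot n$ defined and $m\odot n\le m'\odot n'$. A statement such as $m_1\odot m_2\le m_0$ includes that the product is defined. *Expressions* (up to renaming of bound variables; $x,y$ variables, $l$ locations, $a\in\{\,\cdot\,,\circ,>,<\}$ a kind): $c::=\mathsf{unit}\mid\mathsf{new}_m\mid\mathsf{op}_m\mid\mathsf{split}_{m_1,m_2}\mid\mathsf{drop}$, $M,N::=c\mid l\mid x\mid\lambda^a x.M\mid M\,{}^aN\mid M\otimes N\mid M\odot N\mid \mathsf{let}\ x\otimes y=M\ \mathsf{in}\ N\mid\mathsf{let}\ x\odot y=M\ \mathsf{in}\ N$. *Values* are constants, locations, abstractions, and pairs $V_1\otimes V_2$, $V_1\odot V_2$ of values. *Evaluation contexts*: $\mathcal E::=[\,]\mid\mathcal E\,{}^aM\mid V\,{}^a\mathcal E\ (a\neq{<})\mid\mathcal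 E\,{}^<V\mid M\,{}^<\mathcal E\mid\mathcal E\otimes M\mid V\otimes\mathcal E\mid\mathcal E\odot M\mid V\odot\mathcal E\mid\mathsf{let}\ x\otimes y=\mathcal E\ \mathsf{in}\ M\mid\mathsf{let}\ x\odot y=\mathcal E\ \mathsf{in}\ M$ (with $\mathcal E\,{}^aM$ also only for $a\ne{<}$). *Reduction.* A heap $H$ is a finite map from locations to triples $(n,m_0,m)$ with $n\in\mathbb N$, $m_0,m\in\mathbb M$; $H\cup\{l\mapsto t\}$ is $H$ updated at $l$. The relation $\to_\beta$ is given by $(\lambda^ax.M)\,{}^aV\to_\beta M[V/x]$, and $\mathsf{let}\ x\otimes y=V_1\otimes V_2\ \mathsf{in}\ M\to_\beta M[V_1/x][V_2/y]$ for $x\neq y$, and likewise with $\odot$. The relation $\to_\gamma$ is given by - $\mathsf{new}_m\,\mathsf{unit}\mid H\to_\gamma l\mid H\cup\{l\mapsto(0,m,\varepsilon)\}$ if $l\notin\mathrm{dom}(H)$; - $\mathsf{op}_m\,l\mid H\cup\{l\mapsto(n,m_0,m')\}\to_\gamma l\mid H\cup\{l\mapsto(n,m_0,m'\odot m)\}$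 if $m'\odot m\odot m''\le m_0$ for some $m''$; - $\mathsf{drop}\,l\mid H\cup\{l\mapsto(n+1,m_0,m)\}\to_\gamma\mathsf{unit}\mid H\cup\{l\mapsto(n,m_0,m)\}$; - $\mathsf{drop}\,l\mid H\cup\{l\mapsto(0,m_0,m)\}\to_\gamma\mathsf{unit}\mid H$ if $l\notin\mathrm{dom}(H)$ and $m\le m_0$; - $\mathsf{split}_{m_1,m_2}\,l\mid H\cup\{l\mapsto(n,m_0,m)\}\to_\gamma l\odot l\mid H\cup\{l\mapsto(n+1,m_0,m)\}$. $\mathcal E[M]\mid H\to\mathcal E[M']\mid H$ if $M\to_\beta M'$, and $\mathcal E[M]\mid H\to\mathcal E[M']\mid H'$ if $M\mid H\to_\gamma M'\mid H'$. *Types.* Effects are $e\in\{0,1\}$ with $0\le1$ and maximum $\sqcup$. Types are $S,T::=\mathsf{Unit}\mid[m]\mid S\to^a_eT\mid S\otimes T\mid S\odot T$. Unrestricted types are $\mathsf{Unit}$, all $S\to^{\cdot}_eT$ of the plain kind, and products of two unrestricted types; all other types are ordered. *Contexts.* $\Gamma::=\cdot\mid b\mid\Gamma_1,\Gamma_2\mid\Gamma_1\parallel\Gamma_2$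 with bindings $b::=x:T\mid l:[m]$; a context pattern $\mathcal G$ is a context with one hole. $\mathrm{dom}(\Gamma)$ is the set of variables and locations bound in $\Gamma$, and $\Gamma$ is unrestricted if the types of all its bindings are. $\Gamma$ is well-formed if no variable has two different types in $\Gamma$ and every binding $x:T$ with $T$ ordered occurs at most once. The interpretation of $\Gamma$ is a finite directed graph $\mathfrak G_\Gamma$, whose vertices are labelled by bindings, together with the set $\mathbb S_\Gamma$ of unrestricted bindings of $\Gamma$: an ordered binding is a single vertex, $\cdot$ and unrestricted bindings give the empty graph, $\parallel$ is disjoint union, and "," is disjoint union with additional edges from every vertex of the left part to every vertex of the right part. $\Gamma_1\lesssim\Gamma_2$ means that $\mathbb S_{\Gamma_1}\supseteq\mathbb S_{\Gamma_2}$ and that, up to label-preserving isomorphism, $\mathfrak G_{\Gamma_1}$ has the same labelled vertices as $\mathfrak G_{\Gamma_2}$ and its edges are among those of $\mathfrak G_{\Gamma_2}$. *Typing* $\Gamma\vdash M:T\mid e$ is the least relation on well-formed contexts closed under the following rules. - $\cdot\vdash c:T\mid0$ for $\mathsf{unit}:\mathsf{Unit}$; $\mathsf{new}_m:\mathsf{Unit}\to^{\cdot}_0[m]$;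 $\mathsf{op}_{m_1}:[m_0]\to^{\cdot}_1[m_2]$ if $m_1\odot m_2\le m_0$; $\mathsf{split}_{m_1,m_2}:[m_0]\to^{\cdot}_0([m_1]\odot[m_2])$ if $m_1\odot m_2\le m_0$; $\mathsf{drop}:[m]\to^{\cdot}_0\mathsf{Unit}$ if $\varepsilon\le m$. - $x:T\vdash x:T\mid0$ and $l:[m]\vdash l:[m]\mid0$. - $\Gamma\vdash\lambda^ax.M:S\to^a_eT\mid0$ if $x\notin\mathrm{dom}(\Gamma)$ and $\Delta\vdash M:T\mid e$, where $\Delta$ is $(\Gamma,x:S)$ with $\Gamma$ unrestricted if $a$ is plain, $(\Gamma\parallel x:S)$ if $a=\circ$, $(\Gamma,x:S)$ if $a={>}$, and $(x:S,\Gamma)$ if $a={<}$. - If $\Gamma_1\vdash M:S\to^a_eT\mid e_1$ and $\Gamma_2\vdash N:S\mid e_2$, then $\Gamma\vdash M\,{}^aN:T\mid e\sqcup e_1\sqcup e_2$, where $\Gamma$ is $(\Gamma_1,\Gamma_2)$ if $a$ is plain; $(\Gamma_1\parallel\Gamma_2)$ if $a=\circ$; $(\Gamma_1,\Gamma_2)$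 if $a={>}$, and then $e_2=0$ is required; $(\Gamma_2,\Gamma_1)$ if $a={<}$, and then $e_1=0$ is required. - If $\Gamma_1\vdash M:S\mid e_1$ and $\Gamma_2\vdash N:T\mid e_2$, then $\Gamma_1\parallel\Gamma_2\vdash M\otimes N:S\otimes T\mid e_1\sqcup e_2$; and, if moreover $e_2=0$ or $S$ is not ordered, $\Gamma_1,\Gamma_2\vdash M\odot N:S\odot T\mid e_1\sqcup e_2$. - If $x\ne y$, $x,y\notin\mathrm{dom}(\mathcal G[\Gamma])$, $\Gamma\vdash M:S_1\otimes S_2\mid0$ and $\mathcal G[x:S_1\parallel y:S_2]\vdash N:T\mid e$, then $\mathcal G[\Gamma]\vdash\mathsf{let}\ x\otimes y=M\ \mathsf{in}\ N:T\mid e$; and the same with $\odot$ for $\otimes$ and $(x:S_1,y:S_2)$ for $(x:S_1\parallel y:S_2)$. - If $\Gamma_1\vdash M:T\mid e_1$, $\Gamma_2\lesssim\Gamma_1$ and $e_1\le e_2$, then $\Gamma_2\vdash M:T\mid e_2$. *Heap typing.* A run-time context $C$ is a context without variable bindings; $\langle C\rangle_l$ is $C$ with all bindings of locations other than $l$ replaced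 by $\cdot$. $C\vdash H$ means: for every location $l$ the graph of $\langle C\rangle_l$ has exactly one topological ordering; $\mathrm{dom}(C)=\mathrm{dom}(H)$; and for every $l\in\mathrm{dom}(H)$ with $H(l)=(n,m_0,m)$, the graph of $\langle C\rangle_l$ has $n+1$ vertices and, if $l:[m_1],\dots,l:[m_{n+1}]$ are their labels in the topological ordering, $m\odot(m_1\odot\cdots\odot m_{n+1})\le m_0$. **Theorem.** Let $C$ be a run-time context. If $M\mid H\to M'\mid H'$, $C\vdash M:T\mid e$ and $C\vdash H$, then there is a run-time context $C'$ such that $C'\vdash M':T\mid e$ and $C'\vdash H'$. -/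

import Mathlib

namespace OrdBorrow

universe u

/-- Ordered partial monoids: a partial monoid (`mul m n = none` means that the product is undefined)
with a preorder for which multiplication is monotone and downwards closed. -/
class OPM (P : Type u) extends Preorder P where
  mul : P → P → Option P
  eps : P
  eps_mul : ∀ m, mul eps m = some m
  mul_eps : ∀ m, mul m eps = some m
  /-- Both sides are defined or undefined together, and agree when they are defined. -/
  mul_assoc : ∀ m n o, (mul m n).bind (fun k => mul k o) = (mul n o).bind (fun k => mul m k)
  mul_mono : ∀ m m' n n' p', m ≤ m' → n ≤ n' → mul m' n' = some p' →
    ∃ p, mul m n = some p ∧ p ≤ p'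

/-- `m₁ ⊙ m₂` is defined and `m₁ ⊙ m₂ ≤ m₀`. -/
def MulLe {P : Type u} [OPM P] (m₁ m₂ m₀ : P) : Prop :=
  ∃ p, OPM.mul m₁ m₂ = some p ∧ p ≤ m₀

/-- Variable names. -/
abbrev Var := ℕ

/-- Locations. -/
abbrev Loc := ℕ

/-- Effects: `false` is the effect 0, `true` is the effect 1, `⊔` is the maximum. -/
abbrev Eff := Bool

/-- The four kinds of abstractions, applications and arrow types: non-capturing, unordered,
right ordered (`λ^>`) and left ordered (`λ^<`). -/
inductive Mode where
  | plain | unord | right | left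

/-! ### Expressions -/

/-- Constants. -/
inductive Const (P : Type u) : Type u where
  | unit
  | new (m : P)
  | op (m : P)
  | split (m₁ m₂ : P)
  | drop

/-- Expressions up to renaming of bound variables, in locally nameless style: free variables are
names, bound variables are de Bruijn indices. In `lam a M` the parameter is index `0` of `M`; in
`ulet M N` and `olet M N` (the destructors `let x ⊗ y = M in N` and `let x ⊙ y = M in N`) the
variable `x` is index `1` of `N` and `y` is index `0` of `N`. -/
inductive Expr (P : Type u) : Type u where
  | const (c : Const P)
  | loc (l : Loc)
  | fvar (x : Var)
  | bvar (k : ℕ)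
  | lam (a : Mode) (M : Expr P)
  | app (a : Mode) (M N : Expr P)
  | upair (M N : Expr P)
  | opair (M N : Expr P)
  | ulet (M N : Expr P)
  | olet (M N : Expr P)

namespace Expr

variable {P : Type u}

/-- The free variables. -/
def fv : Expr P → Finset Var
  | const _ => ∅
  | loc _ => ∅
  | fvar x => {x}
  | bvar _ => ∅
  | lam _ M => M.fv
  | app _ M N => M.fv ∪ N.fv
  | upair M N => M.fv ∪ N.fv
  | opair M N => M.fv ∪ N.fv
  | ulet M N => M.fv ∪ N.fv
  | olet M N => M.fv ∪ N.fv

/-- Replace the bound variable with index `k` by `U`. -/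
def openAt (k : ℕ) (U : Expr P) : Expr P → Expr P
  | const c => const c
  | loc l => loc l
  | fvar x => fvar x
  | bvar i => if i = k then U else bvar i
  | lam a M => lam a (openAt (k + 1) U M)
  | app a M N => app a (openAt k U M) (openAt k U N)
  | upair M N => upair (openAt k U M) (openAt k U N)
  | opair M N => opair (openAt k U M) (openAt k U N)
  | ulet M N => ulet (openAt k U M) (openAt (k + 2) U N)
  | olet M N => olet (openAt k U M) (openAt (k + 2) U N)

/-- `M[U/x]` for the body `M` of an abstraction with parameter `x`. -/
def open1 (U M : Expr P) : Expr P := openAt 0 U M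

/-- `M[U/x][W/y]` for the body `M` of a destructor that binds `x` and `y`. -/
def open2 (U W M : Expr P) : Expr P := openAt 0 W (openAt 1 U M)

/-- Values. -/
inductive IsValue : Expr P → Prop where
  | const (c : Const P) : IsValue (const c)
  | loc (l : Loc) : IsValue (loc l)
  | lam (a : Mode) (M : Expr P) : IsValue (lam a M)
  | upair {V W : Expr P} : IsValue V → IsValue W → IsValue (upair V W)
  | opair {V W : Expr P} : IsValue V → IsValue W → IsValue (opair V W)

end Expr

/-- Evaluation contexts. Evaluation goes from left to right, except for left application. -/
inductive ECtx (P : Type u) : Type u where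
  | hole
  | appL (a : Mode) (ha : a ≠ Mode.left) (E : ECtx P) (M : Expr P)
  | appR (a : Mode) (ha : a ≠ Mode.left) (V : Expr P) (hV : V.IsValue) (E : ECtx P)
  | lappL (E : ECtx P) (V : Expr P) (hV : V.IsValue)
  | lappR (M : Expr P) (E : ECtx P)
  | upairL (E : ECtx P) (M : Expr P)
  | upairR (V : Expr P) (hV : V.IsValue) (E : ECtx P)
  | opairL (E : ECtx P) (M : Expr P)
  | opairR (V : Expr P) (hV : V.IsValue) (E : ECtx P)
  | ulet (E : ECtx P) (N : Expr P)
  | olet (E : ECtx P) (N : Expr P)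

/-- `E[M]`. -/
def ECtx.fill {P : Type u} : ECtx P → Expr P → Expr P
  | hole, M => M
  | appL a _ E N, M => Expr.app a (E.fill M) N
  | appR a _ V _ E, M => Expr.app a V (E.fill M)
  | lappL E V _, M => Expr.app Mode.left (E.fill M) V
  | lappR N E, M => Expr.app Mode.left N (E.fill M)
  | upairL E N, M => Expr.upair (E.fill M) N
  | upairR V _ E, M => Expr.upair V (E.fill M)
  | opairL E N, M => Expr.opair (E.fill M) N
  | opairR V _ E, M => Expr.opair V (E.fill M)
  | ulet E N, M => Expr.ulet (E.fill M) N
  | olet E N, M => Expr.olet (E.fill M) N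

/-! ### Heaps and reduction -/

/-- Heap entries `(n, m₀, m)`: a reference count (`0` denotes one reference), the usage specified
at creation, and the trace of the operations applied so far. -/
structure Cell (P : Type u) : Type u where
  refs : ℕ
  spec : P
  trace : P

/-- Heaps: finite maps from locations to entries. -/
abbrev Heap (P : Type u) : Type u := Finmap (fun _ : Loc => Cell P)

/-- Expression reduction. -/
inductive BetaStep {P : Type u} : Expr P → Expr P → Prop where
  | beta (a : Mode) (M V : Expr P) (hV : V.IsValue) :
      BetaStep (Expr.app a (Expr.lam a M) V) (Expr.open1 V M)
  | ulet (V₁ V₂ M : Expr P) (h₁ : V₁.IsValue) (h₂ : V₂.IsValue) :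
      BetaStep (Expr.ulet (Expr.upair V₁ V₂) M) (Expr.open2 V₁ V₂ M)
  | olet (V₁ V₂ M : Expr P) (h₁ : V₁.IsValue) (h₂ : V₂.IsValue) :
      BetaStep (Expr.olet (Expr.opair V₁ V₂) M) (Expr.open2 V₁ V₂ M)

/-- Configuration reduction. `H.insert l c` is the heap `H ∪ {l ↦ c}`, updated at `l`. -/
inductive CfgStep {P : Type u} [OPM P] : Expr P → Heap P → Expr P → Heap P → Prop where
  | new (m : P) (l : Loc) (H : Heap P) (hl : l ∉ H) :
      CfgStep (Expr.app Mode.plain (Expr.const (Const.new m)) (Expr.const Const.unit)) H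
        (Expr.loc l) (H.insert l ⟨0, m, OPM.eps⟩)
  | op (m : P) (l : Loc) (H : Heap P) (n : ℕ) (m₀ m' p : P)
      (hp : OPM.mul m' m = some p) (hm : ∃ m'', MulLe p m'' m₀) :
      CfgStep (Expr.app Mode.plain (Expr.const (Const.op m)) (Expr.loc l))
        (H.insert l ⟨n, m₀, m'⟩) (Expr.loc l) (H.insert l ⟨n, m₀, p⟩)
  | drop₁ (l : Loc) (H : Heap P) (n : ℕ) (m₀ m : P) :
      CfgStep (Expr.app Mode.plain (Expr.const Const.drop) (Expr.loc l))
        (H.insert l ⟨n + 1, m₀, m⟩) (Expr.const Const.unit) (H.insert l ⟨n, m₀, m⟩)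
  | drop₂ (l : Loc) (H : Heap P) (m₀ m : P) (hl : l ∉ H) (hm : m ≤ m₀) :
      CfgStep (Expr.app Mode.plain (Expr.const Const.drop) (Expr.loc l))
        (H.insert l ⟨0, m₀, m⟩) (Expr.const Const.unit) H
  | split (m₁ m₂ : P) (l : Loc) (H : Heap P) (n : ℕ) (m₀ m : P) :
      CfgStep (Expr.app Mode.plain (Expr.const (Const.split m₁ m₂)) (Expr.loc l))
        (H.insert l ⟨n, m₀, m⟩) (Expr.opair (Expr.loc l) (Expr.loc l))
        (H.insert l ⟨n + 1, m₀, m⟩)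

/-- Contextual reduction `M | H ⟶ M' | H'`. -/
inductive Step {P : Type u} [OPM P] : Expr P → Heap P → Expr P → Heap P → Prop where
  | exp (E : ECtx P) {M M' : Expr P} (H : Heap P) (h : BetaStep M M') :
      Step (E.fill M) H (E.fill M') H
  | cfg (E : ECtx P) {M M' : Expr P} {H H' : Heap P} (h : CfgStep M H M' H') :
      Step (E.fill M) H (E.fill M') H'

/-! ### Types and typing contexts -/

/-- Types; `res m` is the resource type `[m]`, and `arr a e S T` is the arrow of kind `a` with
latent effect `e`. -/
inductive Ty (P : Type u) : Type u where
  | unit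
  | res (m : P)
  | arr (a : Mode) (e : Eff) (S T : Ty P)
  | uprod (S T : Ty P)
  | oprod (S T : Ty P)

/-- Unrestricted types. -/
inductive Ty.Unr {P : Type u} : Ty P → Prop where
  | unit : Ty.Unr Ty.unit
  | arr (e : Eff) (S T : Ty P) : Ty.Unr (Ty.arr Mode.plain e S T)
  | uprod {S T : Ty P} : Ty.Unr S → Ty.Unr T → Ty.Unr (Ty.uprod S T)
  | oprod {S T : Ty P} : Ty.Unr S → Ty.Unr T → Ty.Unr (Ty.oprod S T)

/-- Ordered types. -/
inductive Ty.Ord {P : Type u} : Ty P → Prop where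
  | res (m : P) : Ty.Ord (Ty.res m)
  | uarr (e : Eff) (S T : Ty P) : Ty.Ord (Ty.arr Mode.unord e S T)
  | rarr (e : Eff) (S T : Ty P) : Ty.Ord (Ty.arr Mode.right e S T)
  | larr (e : Eff) (S T : Ty P) : Ty.Ord (Ty.arr Mode.left e S T)
  | uprodL {S T : Ty P} : Ty.Ord S → Ty.Ord (Ty.uprod S T)
  | uprodR {S T : Ty P} : Ty.Ord T → Ty.Ord (Ty.uprod S T)
  | oprodL {S T : Ty P} : Ty.Ord S → Ty.Ord (Ty.oprod S T)
  | oprodR {S T : Ty P} : Ty.Ord T → Ty.Ord (Ty.oprod S T)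

/-- Every type is either ordered or unrestricted, and not both. -/
theorem Ty.ord_iff_not_unr {P : Type u} (T : Ty P) : T.Ord ↔ ¬ T.Unr := by
  induction T with
  | unit => exact ⟨fun h => (nomatch h), fun h => (h Ty.Unr.unit).elim⟩
  | res m => exact ⟨fun _ h => (nomatch h), fun _ => Ty.Ord.res m⟩
  | arr a e S T _ _ =>
    cases a
    · exact ⟨fun h => (nomatch h), fun h => (h (Ty.Unr.arr e S T)).elim⟩
    · exact ⟨fun _ h => (nomatch h), fun _ => Ty.Ord.uarr e S T⟩
    · exact ⟨fun _ h => (nomatch h), fun _ => Ty.Ord.rarr e S T⟩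
    · exact ⟨fun _ h => (nomatch h), fun _ => Ty.Ord.larr e S T⟩
  | uprod S T hS hT =>
    constructor
    · intro h h'
      cases h' with
      | uprod h₁ h₂ =>
        cases h with
        | uprodL h => exact hS.1 h h₁
        | uprodR h => exact hT.1 h h₂
    · intro h
      by_cases h₁ : S.Unr
      · exact Ty.Ord.uprodR (hT.2 fun h₂ => h (Ty.Unr.uprod h₁ h₂))
      · exact Ty.Ord.uprodL (hS.2 h₁)
  | oprod S T hS hT =>
    constructor
    · intro h h'
      cases h' with
      | oprod h₁ h₂ =>
        cases h with
        | oprodL h => exact hS.1 h h₁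
        | oprodR h => exact hT.1 h h₂
    · intro h
      by_cases h₁ : S.Unr
      · exact Ty.Ord.oprodR (hT.2 fun h₂ => h (Ty.Unr.oprod h₁ h₂))
      · exact Ty.Ord.oprodL (hS.2 h₁)

/-- The things that a typing context binds. -/
inductive Name where
  | var (x : Var)
  | loc (l : Loc)

/-- Bindings `x : T` and `l : [m]`. -/
inductive Binding (P : Type u) : Type u where
  | var (x : Var) (T : Ty P)
  | loc (l : Loc) (m : P)

namespace Binding

variable {P : Type u}

def name : Binding P → Name
  | var x _ => Name.var x
  | loc l _ => Name.loc l

/-- The type part of a binding. -/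
def ty : Binding P → Ty P
  | var _ T => T
  | loc _ m => Ty.res m

def Unr (b : Binding P) : Prop := b.ty.Unr

end Binding

/-- Typing contexts: `seq Γ₁ Γ₂` is `Γ₁ , Γ₂` (ordered) and `par Γ₁ Γ₂` is `Γ₁ ∥ Γ₂`. -/
inductive Ctx (P : Type u) : Type u where
  | empty
  | bind (b : Binding P)
  | seq (Γ₁ Γ₂ : Ctx P)
  | par (Γ₁ Γ₂ : Ctx P)

/-- Context patterns. -/
inductive CtxPat (P : Type u) : Type u where
  | hole
  | seqR (Γ : Ctx P) (G : CtxPat P)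
  | seqL (G : CtxPat P) (Γ : Ctx P)
  | parR (Γ : Ctx P) (G : CtxPat P)
  | parL (G : CtxPat P) (Γ : Ctx P)

/-- `G[Δ]`. -/
def CtxPat.fill {P : Type u} : CtxPat P → Ctx P → Ctx P
  | hole, Δ => Δ
  | seqR Γ G, Δ => Ctx.seq Γ (G.fill Δ)
  | seqL G Γ, Δ => Ctx.seq (G.fill Δ) Γ
  | parR Γ G, Δ => Ctx.par Γ (G.fill Δ)
  | parL G Γ, Δ => Ctx.par (G.fill Δ) Γ

/-- Graph representations `(n, v, E)`: a directed graph on `{0, …, n - 1}` whose vertices are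
labelled by bindings. The ones used below are acyclic, see `Ctx.graph_acyclic`. -/
structure Graph (P : Type u) : Type u where
  n : ℕ
  v : Fin n → Binding P
  E : Fin n → Fin n → Prop

namespace Graph

variable {P : Type u}

/-- The graph without vertices. -/
def nil : Graph P := ⟨0, Fin.elim0, fun _ _ => False⟩

/-- The graph with one vertex. -/
def single (b : Binding P) : Graph P := ⟨1, fun _ => b, fun _ _ => False⟩

/-- Disjoint union. -/
def union (G K : Graph P) : Graph P where
  n := G.n + K.n
  v := Fin.append G.v K.v
  E a b :=
    (∃ i j, G.E i j ∧ a = Fin.castAdd K.n i ∧ b = Fin.castAdd K.n j) ∨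
    (∃ i j, K.E i j ∧ a = Fin.natAdd G.n i ∧ b = Fin.natAdd G.n j)

/-- Disjoint union, with additional edges from all vertices of `G` to all vertices of `K`. -/
def join (G K : Graph P) : Graph P where
  n := G.n + K.n
  v := Fin.append G.v K.v
  E a b :=
    (∃ i j, G.E i j ∧ a = Fin.castAdd K.n i ∧ b = Fin.castAdd K.n j) ∨
    (∃ i j, K.E i j ∧ a = Fin.natAdd G.n i ∧ b = Fin.natAdd G.n j) ∨
    (∃ i j, a = Fin.castAdd K.n i ∧ b = Fin.natAdd G.n j)

/-- Isomorphism of graph representations. -/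
def Iso (G K : Graph P) : Prop :=
  ∃ f : Fin K.n ≃ Fin G.n, (∀ i j, G.E (f i) (f j) ↔ K.E i j) ∧ ∀ i, G.v (f i) = K.v i

/-- `G` is a spanning graph representation of `K`: same vertices and labels, and every edge of
`G` is an edge of `K`. -/
def Spanning (G K : Graph P) : Prop :=
  ∃ h : G.n = K.n, (∀ i, G.v i = K.v (Fin.cast h i)) ∧
    ∀ i j, G.E i j → K.E (Fin.cast h i) (Fin.cast h j)

/-- Topological orderings; `f k` is the vertex at position `k`. -/
def IsTopOrder (G : Graph P) (f : Fin G.n ≃ Fin G.n) : Prop :=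
  ∀ i j, G.E i j → f.symm i < f.symm j

theorem union_edge_lt {G K : Graph P} (hG : ∀ i j, G.E i j → i < j)
    (hK : ∀ i j, K.E i j → i < j) : ∀ i j, (G.union K).E i j → i < j := by
  rintro a b (⟨i, j, h, rfl, rfl⟩ | ⟨i, j, h, rfl, rfl⟩)
  · exact hG i j h
  · exact Nat.add_lt_add_left (hK i j h) G.n

theorem join_edge_lt {G K : Graph P} (hG : ∀ i j, G.E i j → i < j)
    (hK : ∀ i j, K.E i j → i < j) : ∀ i j, (G.join K).E i j → i < j := by
  rintro a b (⟨i, j, h, rfl, rfl⟩ | ⟨i, j, h, rfl, rfl⟩ | ⟨i, j, rfl, rfl⟩)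
  · exact hG i j h
  · exact Nat.add_lt_add_left (hK i j h) G.n
  · exact Nat.lt_of_lt_of_le i.isLt (Nat.le_add_right G.n j)

end Graph

namespace Ctx

variable {P : Type u}

open Classical in
/-- The number of occurrences of the binding `b`. -/
noncomputable def count (b : Binding P) : Ctx P → ℕ
  | empty => 0
  | bind b' => if b' = b then 1 else 0
  | seq Γ₁ Γ₂ => count b Γ₁ + count b Γ₂
  | par Γ₁ Γ₂ => count b Γ₁ + count b Γ₂

/-- `b ∈ Γ`. -/
def Has (Γ : Ctx P) (b : Binding P) : Prop := 0 < Γ.count b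

/-- The set of variables and locations bound in a context. -/
def dom (Γ : Ctx P) : Set Name := {x | ∃ b, Γ.Has b ∧ b.name = x}

/-- All bindings are unrestricted. -/
def Unr (Γ : Ctx P) : Prop := ∀ b, Γ.Has b → b.Unr

/-- Well-formed contexts: every variable has a unique type, and variable bindings of ordered type
occur at most once. -/
def WF (Γ : Ctx P) : Prop :=
  (∀ x S T, Γ.Has (Binding.var x S) → Γ.Has (Binding.var x T) → S = T) ∧
  (∀ x T, Ty.Ord T → Γ.count (Binding.var x T) ≤ 1)

open Classical in
/-- The graph part of the interpretation of a context. -/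
noncomputable def graph : Ctx P → Graph P
  | empty => Graph.nil
  | bind b => if b.Unr then Graph.nil else Graph.single b
  | seq Γ₁ Γ₂ => Γ₁.graph.join Γ₂.graph
  | par Γ₁ Γ₂ => Γ₁.graph.union Γ₂.graph

/-- The set part of the interpretation of a context: its unrestricted bindings. -/
def unrSet : Ctx P → Set (Binding P)
  | empty => ∅
  | bind b => {b' | b' = b ∧ b.Unr}
  | seq Γ₁ Γ₂ => Γ₁.unrSet ∪ Γ₂.unrSet
  | par Γ₁ Γ₂ => Γ₁.unrSet ∪ Γ₂.unrSet

theorem graph_edge_lt (Γ : Ctx P) : ∀ i j, Γ.graph.E i j → i < j := by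
  induction Γ with
  | empty => intro i j h; exact h.elim
  | bind b =>
    have h : (bind b).graph = Graph.nil ∨ (bind b).graph = Graph.single b := by
      by_cases hb : b.Unr
      · exact Or.inl (if_pos hb)
      · exact Or.inr (if_neg hb)
    rcases h with h | h <;> rw [h] <;> exact fun _ _ h => h.elim
  | seq Γ₁ Γ₂ h₁ h₂ => exact Graph.join_edge_lt h₁ h₂
  | par Γ₁ Γ₂ h₁ h₂ => exact Graph.union_edge_lt h₁ h₂

/-- The graph of a context is acyclic, and so is every graph that is isomorphic to it. -/
theorem graph_acyclic (Γ : Ctx P) : ∀ i, ¬ Relation.TransGen Γ.graph.E i i := by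
  have key : ∀ i j, Relation.TransGen Γ.graph.E i j → i < j := by
    intro i j h
    induction h with
    | single h => exact Γ.graph_edge_lt _ _ h
    | tail _ h ih => exact ih.trans (Γ.graph_edge_lt _ _ h)
  exact fun i h => lt_irrefl i (key i i h)

/-- The subcontext relation `Γ₁ ≲ Γ₂`. -/
def Sub (Γ₁ Γ₂ : Ctx P) : Prop :=
  (∃ G₁ G₂ : Graph P, Γ₁.graph.Iso G₁ ∧ G₁.Spanning G₂ ∧ G₂.Iso Γ₂.graph) ∧
    Γ₂.unrSet ⊆ Γ₁.unrSet

end Ctx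

/-! ### Typing -/

/-- The typing of constants. -/
inductive ConstTyping {P : Type u} [OPM P] : Const P → Ty P → Prop where
  | unit : ConstTyping Const.unit Ty.unit
  | new (m : P) : ConstTyping (Const.new m) (Ty.arr Mode.plain false Ty.unit (Ty.res m))
  | op (m₀ m₁ m₂ : P) (h : MulLe m₁ m₂ m₀) :
      ConstTyping (Const.op m₁) (Ty.arr Mode.plain true (Ty.res m₀) (Ty.res m₂))
  | split (m₀ m₁ m₂ : P) (h : MulLe m₁ m₂ m₀) :
      ConstTyping (Const.split m₁ m₂)
        (Ty.arr Mode.plain false (Ty.res m₀) (Ty.oprod (Ty.res m₁) (Ty.res m₂)))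
  | drop (m : P) (h : OPM.eps ≤ m) :
      ConstTyping Const.drop (Ty.arr Mode.plain false (Ty.res m) Ty.unit)

/-- The typing judgment `Γ ⊢ M : T | e`. Only well-formed contexts are used, so each rule asks that
the context of its conclusion is well-formed. In the rules for binders, the names `x` and `y` of the
bound variables are not free in the scope before it is opened. -/
inductive Typing {P : Type u} [OPM P] : Ctx P → Expr P → Ty P → Eff → Prop where
  | const {c : Const P} {T : Ty P} (h : ConstTyping c T) :
      Typing Ctx.empty (Expr.const c) T false
  | var (x : Var) (T : Ty P) :
      Typing (Ctx.bind (Binding.var x T)) (Expr.fvar x) T false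
  | loc (l : Loc) (m : P) :
      Typing (Ctx.bind (Binding.loc l m)) (Expr.loc l) (Ty.res m) false
  | abs {Γ : Ctx P} {M : Expr P} {S T : Ty P} {e : Eff} (x : Var)
      (hΓ : Γ.WF) (hx : Name.var x ∉ Γ.dom) (hM : x ∉ M.fv) (hU : Γ.Unr)
      (h : Typing (Ctx.seq Γ (Ctx.bind (Binding.var x S))) (Expr.open1 (Expr.fvar x) M) T e) :
      Typing Γ (Expr.lam Mode.plain M) (Ty.arr Mode.plain e S T) false
  | uabs {Γ : Ctx P} {M : Expr P} {S T : Ty P} {e : Eff} (x : Var)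
      (hΓ : Γ.WF) (hx : Name.var x ∉ Γ.dom) (hM : x ∉ M.fv)
      (h : Typing (Ctx.par Γ (Ctx.bind (Binding.var x S))) (Expr.open1 (Expr.fvar x) M) T e) :
      Typing Γ (Expr.lam Mode.unord M) (Ty.arr Mode.unord e S T) false
  | rabs {Γ : Ctx P} {M : Expr P} {S T : Ty P} {e : Eff} (x : Var)
      (hΓ : Γ.WF) (hx : Name.var x ∉ Γ.dom) (hM : x ∉ M.fv)
      (h : Typing (Ctx.seq Γ (Ctx.bind (Binding.var x S))) (Expr.open1 (Expr.fvar x) M) T e) :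
      Typing Γ (Expr.lam Mode.right M) (Ty.arr Mode.right e S T) false
  | labs {Γ : Ctx P} {M : Expr P} {S T : Ty P} {e : Eff} (x : Var)
      (hΓ : Γ.WF) (hx : Name.var x ∉ Γ.dom) (hM : x ∉ M.fv)
      (h : Typing (Ctx.seq (Ctx.bind (Binding.var x S)) Γ) (Expr.open1 (Expr.fvar x) M) T e) :
      Typing Γ (Expr.lam Mode.left M) (Ty.arr Mode.left e S T) false
  | app {Γ₁ Γ₂ : Ctx P} {M N : Expr P} {S T : Ty P} {e e₁ e₂ : Eff}
      (hΓ : (Ctx.seq Γ₁ Γ₂).WF)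
      (h₁ : Typing Γ₁ M (Ty.arr Mode.plain e S T) e₁) (h₂ : Typing Γ₂ N S e₂) :
      Typing (Ctx.seq Γ₁ Γ₂) (Expr.app Mode.plain M N) T (e ⊔ e₁ ⊔ e₂)
  | uapp {Γ₁ Γ₂ : Ctx P} {M N : Expr P} {S T : Ty P} {e e₁ e₂ : Eff}
      (hΓ : (Ctx.par Γ₁ Γ₂).WF)
      (h₁ : Typing Γ₁ M (Ty.arr Mode.unord e S T) e₁) (h₂ : Typing Γ₂ N S e₂) :
      Typing (Ctx.par Γ₁ Γ₂) (Expr.app Mode.unord M N) T (e ⊔ e₁ ⊔ e₂)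
  | rapp {Γ₁ Γ₂ : Ctx P} {M N : Expr P} {S T : Ty P} {e e₁ : Eff}
      (hΓ : (Ctx.seq Γ₁ Γ₂).WF)
      (h₁ : Typing Γ₁ M (Ty.arr Mode.right e S T) e₁) (h₂ : Typing Γ₂ N S false) :
      Typing (Ctx.seq Γ₁ Γ₂) (Expr.app Mode.right M N) T (e ⊔ e₁)
  | lapp {Γ₁ Γ₂ : Ctx P} {M N : Expr P} {S T : Ty P} {e e₂ : Eff}
      (hΓ : (Ctx.seq Γ₁ Γ₂).WF)
      (h₁ : Typing Γ₂ M (Ty.arr Mode.left e S T) false) (h₂ : Typing Γ₁ N S e₂) :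
      Typing (Ctx.seq Γ₁ Γ₂) (Expr.app Mode.left M N) T (e ⊔ e₂)
  | upair {Γ₁ Γ₂ : Ctx P} {M N : Expr P} {S T : Ty P} {e₁ e₂ : Eff}
      (hΓ : (Ctx.par Γ₁ Γ₂).WF)
      (h₁ : Typing Γ₁ M S e₁) (h₂ : Typing Γ₂ N T e₂) :
      Typing (Ctx.par Γ₁ Γ₂) (Expr.upair M N) (Ty.uprod S T) (e₁ ⊔ e₂)
  | opair {Γ₁ Γ₂ : Ctx P} {M N : Expr P} {S T : Ty P} {e₁ e₂ : Eff}
      (hΓ : (Ctx.seq Γ₁ Γ₂).WF) (hS : S.Ord → e₂ = false)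
      (h₁ : Typing Γ₁ M S e₁) (h₂ : Typing Γ₂ N T e₂) :
      Typing (Ctx.seq Γ₁ Γ₂) (Expr.opair M N) (Ty.oprod S T) (e₁ ⊔ e₂)
  | ulet {G : CtxPat P} {Γ : Ctx P} {M N : Expr P} {S₁ S₂ T : Ty P} {e : Eff} (x y : Var)
      (hΓ : (G.fill Γ).WF) (hxy : x ≠ y)
      (hx : Name.var x ∉ (G.fill Γ).dom) (hy : Name.var y ∉ (G.fill Γ).dom)
      (hxN : x ∉ N.fv) (hyN : y ∉ N.fv)
      (h₁ : Typing Γ M (Ty.uprod S₁ S₂) false)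
      (h₂ : Typing
        (G.fill (Ctx.par (Ctx.bind (Binding.var x S₁)) (Ctx.bind (Binding.var y S₂))))
        (Expr.open2 (Expr.fvar x) (Expr.fvar y) N) T e) :
      Typing (G.fill Γ) (Expr.ulet M N) T e
  | olet {G : CtxPat P} {Γ : Ctx P} {M N : Expr P} {S₁ S₂ T : Ty P} {e : Eff} (x y : Var)
      (hΓ : (G.fill Γ).WF) (hxy : x ≠ y)
      (hx : Name.var x ∉ (G.fill Γ).dom) (hy : Name.var y ∉ (G.fill Γ).dom)
      (hxN : x ∉ N.fv) (hyN : y ∉ N.fv)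
      (h₁ : Typing Γ M (Ty.oprod S₁ S₂) false)
      (h₂ : Typing
        (G.fill (Ctx.seq (Ctx.bind (Binding.var x S₁)) (Ctx.bind (Binding.var y S₂))))
        (Expr.open2 (Expr.fvar x) (Expr.fvar y) N) T e) :
      Typing (G.fill Γ) (Expr.olet M N) T e
  | weaken {Γ₁ Γ₂ : Ctx P} {M : Expr P} {T : Ty P} {e₁ e₂ : Eff}
      (hΓ : Γ₂.WF) (h : Typing Γ₁ M T e₁) (hs : Γ₂.Sub Γ₁) (he : e₁ ≤ e₂) :
      Typing Γ₂ M T e₂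

/-! ### Run-time contexts and heap typing -/

namespace Ctx

variable {P : Type u}

/-- Run-time contexts: contexts without variable bindings. -/
def IsRuntime (C : Ctx P) : Prop := ∀ x T, ¬ C.Has (Binding.var x T)

/-- The focus on the location `l`: all bindings of other locations are replaced by the empty
context. -/
def focus (l : Loc) : Ctx P → Ctx P
  | empty => empty
  | bind (Binding.var x T) => bind (Binding.var x T)
  | bind (Binding.loc l' m) => if l' = l then bind (Binding.loc l' m) else empty
  | seq C₁ C₂ => seq (focus l C₁) (focus l C₂)
  | par C₁ C₂ => par (focus l C₁) (focus l C₂)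

/-- For every location, the graph of the focus has a unique topological ordering. -/
def OrderDefined (C : Ctx P) : Prop :=
  ∀ l, ∃! f : Fin (C.focus l).graph.n ≃ Fin (C.focus l).graph.n, (C.focus l).graph.IsTopOrder f

/-- The product `m₁ ⊙ ⋯ ⊙ mₖ` for a sequence `l₁ : [m₁], …, lₖ : [mₖ]` of location bindings, if it
is defined. -/
def usageOf [OPM P] : List (Binding P) → Option P
  | [] => some OPM.eps
  | Binding.var _ _ :: _ => none
  | Binding.loc _ m :: bs => (usageOf bs).bind (fun p => OPM.mul m p)

/-- The usage projection of `C` is defined and equal to `m`. -/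
def HasUsage [OPM P] (C : Ctx P) (m : P) : Prop :=
  ∃ f : Fin C.graph.n ≃ Fin C.graph.n, C.graph.IsTopOrder f ∧
    (∀ g, C.graph.IsTopOrder g → g = f) ∧
    usageOf (List.ofFn fun k => C.graph.v (f k)) = some m

/-- Heap typing `C ⊢ H`. -/
def TypesHeap [OPM P] (C : Ctx P) (H : Heap P) : Prop :=
  C.OrderDefined ∧ C.dom = Name.loc '' {l | l ∈ H} ∧
    ∀ l c, H.lookup l = some c →
      (C.focus l).graph.n = c.refs + 1 ∧
      ∃ u, (C.focus l).HasUsage u ∧ MulLe c.trace u c.spec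

end Ctx

end OrdBorrow

/-! A typing derivation of `E[M]` splits along `E`. Up to `≲`, the context is a pattern `G` filled
with a context `Δ` that types `M`, and `M` can be exchanged for any expression that has the same
type and effect in another run-time context (`Typing.exists_holeTyping`). Passing from a context to
a larger one for `≲` preserves heap typing. Graphs of contexts are acyclic and transitive, so a
unique topological ordering means that any two vertices are comparable (`Chain`). Such a graph can
only be mapped onto one with more edges in an order-preserving way, so the sequence of labels does
not change (`Sub.chain_and_verts_eq`).

A β-step keeps the heap and is handled by the substitution lemma (`Typing.substitution`): the
binding of the variable is replaced by the run-time context of the closed value. If the type is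
unrestricted, the variable may occur often or be discarded. This is harmless because a value of
unrestricted type is typed without ordered bindings (`Typing.isEmpty_vert_of_unr`).

A γ-step changes one location `l`. The bindings of `l` form a chain whose labels multiply to the
remaining usage. Splitting or dropping replaces one factor by something smaller, which by
monotonicity is sound anywhere in the product. An operation moves a factor from the usage to the end
of the trace, so by associativity it must act on the first factor. Effects ensure this. Where the
hole has effect 1, everything sequenced before it is a value of unrestricted type, so no ordered
binding precedes the hole (`CtxPat.Lead`). Contexts parallel to the hole cannot interfere, since in
a chain they contain no other binding of `l` (`CtxPat.Lead.pre_eq_nil`). -/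

namespace OrdBorrow

universe u

/-! ### Graphs of contexts on recursively defined vertex types, and the subcontext relation -/

namespace Ctx

variable {P : Type u}

/-- The vertices of the graph of a context, by recursion on the context. -/
def Vert : Ctx P → Type
  | empty => Empty
  | bind b => PLift (¬ b.Unr)
  | seq Γ₁ Γ₂ => Vert Γ₁ ⊕ Vert Γ₂
  | par Γ₁ Γ₂ => Vert Γ₁ ⊕ Vert Γ₂

/-- The label of a vertex. -/
def lab : (Γ : Ctx P) → Γ.Vert → Binding P
  | empty => Empty.elim
  | bind b => fun _ => b
  | seq Γ₁ Γ₂ => Sum.elim Γ₁.lab Γ₂.lab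
  | par Γ₁ Γ₂ => Sum.elim Γ₁.lab Γ₂.lab

/-- The edge relation on vertices. -/
def edge : (Γ : Ctx P) → Γ.Vert → Γ.Vert → Prop
  | empty => fun _ _ => False
  | bind _ => fun _ _ => False
  | seq Γ₁ Γ₂ => Sum.Lex Γ₁.edge Γ₂.edge
  | par Γ₁ Γ₂ => Sum.LiftRel Γ₁.edge Γ₂.edge

/-- The graph `G` is isomorphic to the graph on `V` with labels `l` and edges `r`. -/
def _root_.OrdBorrow.Graph.Represents (G : Graph P) {V : Type} (l : V → Binding P)
    (r : V → V → Prop) : Prop :=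
  ∃ e : Fin G.n ≃ V, (∀ i, l (e i) = G.v i) ∧ ∀ i j, r (e i) (e j) ↔ G.E i j

theorem _root_.OrdBorrow.Graph.Represents.join {G K : Graph P} {V W : Type} {l : V → Binding P}
    {r : V → V → Prop} {l' : W → Binding P} {r' : W → W → Prop}
    (h : G.Represents l r) (h' : K.Represents l' r') :
    (G.join K).Represents (Sum.elim l l') (Sum.Lex r r') := by
  obtain ⟨e, hl, hr⟩ := h
  obtain ⟨e', hl', hr'⟩ := h'
  let f : Fin (G.n + K.n) ≃ V ⊕ W := finSumFinEquiv.symm.trans (Equiv.sumCongr e e')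
  have fL : ∀ s, f (Fin.castAdd K.n s) = Sum.inl (e s) := fun s => by simp [f]
  have fR : ∀ s, f (Fin.natAdd G.n s) = Sum.inr (e' s) := fun s => by simp [f]
  refine ⟨f, fun i => ?_, fun i j => ?_⟩
  · induction i using Fin.addCases with
    | left s => exact (congrArg _ (fL s)).trans ((hl s).trans (Fin.append_left _ _ s).symm)
    | right s => exact (congrArg _ (fR s)).trans ((hl' s).trans (Fin.append_right _ _ s).symm)
  · induction i using Fin.addCases with
    | left s =>
      induction j using Fin.addCases with
      | left t =>
        refine (Iff.of_eq (congrArg₂ _ (fL s) (fL t))).trans (Sum.lex_inl_inl.trans ((hr s t).trans ?_))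
        simp only [Graph.join, Fin.ext_iff, Fin.val_castAdd, Fin.val_natAdd]
        exact ⟨fun h => Or.inl ⟨s, t, h, rfl, rfl⟩, by grind⟩
      | right t =>
        refine (Iff.of_eq (congrArg₂ _ (fL s) (fR t))).trans ?_
        simp only [Graph.join, Fin.ext_iff, Fin.val_castAdd, Fin.val_natAdd]
        exact ⟨fun _ => Or.inr (Or.inr ⟨s, t, rfl, rfl⟩), fun _ => Sum.Lex.sep _ _⟩
    | right s =>
      induction j using Fin.addCases with
      | left t =>
        refine (Iff.of_eq (congrArg₂ _ (fR s) (fL t))).trans ?_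
        simp only [Graph.join, Fin.ext_iff, Fin.val_castAdd, Fin.val_natAdd]
        exact ⟨fun h => (Sum.lex_inr_inl h).elim, by grind⟩
      | right t =>
        refine (Iff.of_eq (congrArg₂ _ (fR s) (fR t))).trans (Sum.lex_inr_inr.trans ((hr' s t).trans ?_))
        simp only [Graph.join, Fin.ext_iff, Fin.val_castAdd, Fin.val_natAdd]
        exact ⟨fun h => Or.inr (Or.inl ⟨s, t, h, rfl, rfl⟩), by grind⟩

theorem _root_.OrdBorrow.Graph.Represents.union {G K : Graph P} {V W : Type} {l : V → Binding P}
    {r : V → V → Prop} {l' : W → Binding P} {r' : W → W → Prop}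
    (h : G.Represents l r) (h' : K.Represents l' r') :
    (G.union K).Represents (Sum.elim l l') (Sum.LiftRel r r') := by
  obtain ⟨e, hl, hr⟩ := h
  obtain ⟨e', hl', hr'⟩ := h'
  let f : Fin (G.n + K.n) ≃ V ⊕ W := finSumFinEquiv.symm.trans (Equiv.sumCongr e e')
  have fL : ∀ s, f (Fin.castAdd K.n s) = Sum.inl (e s) := fun s => by simp [f]
  have fR : ∀ s, f (Fin.natAdd G.n s) = Sum.inr (e' s) := fun s => by simp [f]
  refine ⟨f, fun i => ?_, fun i j => ?_⟩
  · induction i using Fin.addCases with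
    | left s => exact (congrArg _ (fL s)).trans ((hl s).trans (Fin.append_left _ _ s).symm)
    | right s => exact (congrArg _ (fR s)).trans ((hl' s).trans (Fin.append_right _ _ s).symm)
  · induction i using Fin.addCases with
    | left s =>
      induction j using Fin.addCases with
      | left t =>
        refine (Iff.of_eq (congrArg₂ _ (fL s) (fL t))).trans (Sum.liftRel_inl_inl.trans ((hr s t).trans ?_))
        simp only [Graph.union, Fin.ext_iff, Fin.val_castAdd, Fin.val_natAdd]
        exact ⟨fun h => Or.inl ⟨s, t, h, rfl, rfl⟩, by grind⟩
      | right t =>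
        refine (Iff.of_eq (congrArg₂ _ (fL s) (fR t))).trans ?_
        simp only [Graph.union, Fin.ext_iff, Fin.val_castAdd, Fin.val_natAdd]
        exact ⟨fun h => (Sum.not_liftRel_inl_inr h).elim, by grind⟩
    | right s =>
      induction j using Fin.addCases with
      | left t =>
        refine (Iff.of_eq (congrArg₂ _ (fR s) (fL t))).trans ?_
        simp only [Graph.union, Fin.ext_iff, Fin.val_castAdd, Fin.val_natAdd]
        exact ⟨fun h => (Sum.not_liftRel_inr_inl h).elim, by grind⟩
      | right t =>
        refine (Iff.of_eq (congrArg₂ _ (fR s) (fR t))).trans (Sum.liftRel_inr_inr.trans ((hr' s t).trans ?_))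
        simp only [Graph.union, Fin.ext_iff, Fin.val_castAdd, Fin.val_natAdd]
        exact ⟨fun h => Or.inr ⟨s, t, h, rfl, rfl⟩, by grind⟩

theorem graph_represents (Γ : Ctx P) : Γ.graph.Represents Γ.lab Γ.edge := by
  induction Γ with
  | empty => exact ⟨Equiv.equivOfIsEmpty (Fin 0) Empty, fun i => i.elim0, fun i => i.elim0⟩
  | bind b =>
    by_cases hb : b.Unr
    · have : IsEmpty (bind b).Vert := ⟨fun h => h.down hb⟩
      rw [show (bind b).graph = Graph.nil from if_pos hb]
      exact ⟨Equiv.equivOfIsEmpty (Fin 0) _, fun i => i.elim0, fun i => i.elim0⟩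
    · have : Unique (bind b).Vert := ⟨⟨⟨hb⟩⟩, fun _ => rfl⟩
      rw [show (bind b).graph = Graph.single b from if_neg hb]
      exact ⟨Equiv.ofUnique (Fin 1) _, fun i => rfl, fun i j => Iff.rfl⟩
  | seq Γ₁ Γ₂ h₁ h₂ => exact h₁.join h₂
  | par Γ₁ Γ₂ h₁ h₂ => exact h₁.union h₂

/-- The two isomorphisms around the spanning subgraph compose to one bijection. In this form `≲` is
checked by cases on sum types instead of index arithmetic on `Fin`. -/
theorem sub_iff {Γ₁ Γ₂ : Ctx P} : Γ₁.Sub Γ₂ ↔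
    (∃ e : Γ₁.Vert ≃ Γ₂.Vert, (∀ v, Γ₂.lab (e v) = Γ₁.lab v) ∧
      ∀ v w, Γ₁.edge v w → Γ₂.edge (e v) (e w)) ∧ Γ₂.unrSet ⊆ Γ₁.unrSet := by
  obtain ⟨e₁, l₁, r₁⟩ := Γ₁.graph_represents
  obtain ⟨e₂, l₂, r₂⟩ := Γ₂.graph_represents
  refine and_congr_left fun _ => ⟨?_, ?_⟩
  · rintro ⟨G₁, G₂, ⟨f, hfE, hfv⟩, ⟨h, hv, hE⟩, ⟨g, hgE, hgv⟩⟩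
    refine ⟨e₁.symm.trans (f.symm.trans ((finCongr h).trans (g.symm.trans e₂))), fun v => ?_,
      fun v w hvw => ?_⟩
    · obtain ⟨i, rfl⟩ := e₁.surjective v
      obtain ⟨i, rfl⟩ := f.surjective i
      simp [l₁, l₂, hfv, hv, ← hgv]
    · obtain ⟨i, rfl⟩ := e₁.surjective v
      obtain ⟨i, rfl⟩ := f.surjective i
      obtain ⟨j, rfl⟩ := e₁.surjective w
      obtain ⟨j, rfl⟩ := f.surjective j
      rw [r₁, hfE] at hvw
      simpa [r₂, ← hgE] using hE _ _ hvw
  · rintro ⟨e, hl, hE⟩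
    -- The spanning graph lives on the vertices of `Γ₂.graph`, with the edges of `Γ₁.graph` pulled
    -- back along `f`.
    let f : Fin Γ₂.graph.n ≃ Fin Γ₁.graph.n := e₂.trans (e.symm.trans e₁.symm)
    refine ⟨⟨Γ₂.graph.n, Γ₂.graph.v, fun i j => Γ₁.graph.E (f i) (f j)⟩, Γ₂.graph,
      ⟨f, fun i j => Iff.rfl, fun i => ?_⟩, ⟨rfl, fun i => rfl, fun i j h => ?_⟩,
      ⟨Equiv.refl _, fun i j => Iff.rfl, fun i => rfl⟩⟩
    · change Γ₁.graph.v (f i) = Γ₂.graph.v i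
      rw [← l₁, ← l₂, ← hl]
      simp [f]
    · change Γ₂.graph.E i j
      change Γ₁.graph.E (f i) (f j) at h
      rw [← r₁] at h
      rw [← r₂]
      simpa [f] using hE _ _ h

theorem Sub.refl (Γ : Ctx P) : Γ.Sub Γ :=
  sub_iff.2 ⟨⟨Equiv.refl _, fun _ => rfl, fun _ _ h => h⟩, subset_rfl⟩

theorem Sub.trans {Γ₁ Γ₂ Γ₃ : Ctx P} (h : Γ₁.Sub Γ₂) (h' : Γ₂.Sub Γ₃) : Γ₁.Sub Γ₃ := by
  obtain ⟨⟨e, hl, hE⟩, hu⟩ := sub_iff.1 h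
  obtain ⟨⟨e', hl', hE'⟩, hu'⟩ := sub_iff.1 h'
  exact sub_iff.2 ⟨⟨e.trans e', fun v => (hl' _).trans (hl v), fun v w h => hE' _ _ (hE _ _ h)⟩,
    hu'.trans hu⟩

theorem Sub.seq {Γ₁ Γ₂ Δ₁ Δ₂ : Ctx P} (h : Γ₁.Sub Δ₁) (h' : Γ₂.Sub Δ₂) :
    (Γ₁.seq Γ₂).Sub (Δ₁.seq Δ₂) := by
  obtain ⟨⟨e, hl, hE⟩, hu⟩ := sub_iff.1 h
  obtain ⟨⟨e', hl', hE'⟩, hu'⟩ := sub_iff.1 h'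
  refine sub_iff.2 ⟨⟨Equiv.sumCongr e e', ?_, ?_⟩, Set.union_subset_union hu hu'⟩
  · rintro (v | v)
    exacts [hl v, hl' v]
  · rintro _ _ (h | h | _)
    exacts [Sum.Lex.inl (hE _ _ h), Sum.Lex.inr (hE' _ _ h), Sum.Lex.sep _ _]

theorem Sub.par {Γ₁ Γ₂ Δ₁ Δ₂ : Ctx P} (h : Γ₁.Sub Δ₁) (h' : Γ₂.Sub Δ₂) :
    (Γ₁.par Γ₂).Sub (Δ₁.par Δ₂) := by
  obtain ⟨⟨e, hl, hE⟩, hu⟩ := sub_iff.1 h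
  obtain ⟨⟨e', hl', hE'⟩, hu'⟩ := sub_iff.1 h'
  refine sub_iff.2 ⟨⟨Equiv.sumCongr e e', ?_, ?_⟩, Set.union_subset_union hu hu'⟩
  · rintro (v | v)
    exacts [hl v, hl' v]
  · rintro _ _ (h | h)
    exacts [Sum.LiftRel.inl (hE _ _ h), Sum.LiftRel.inr (hE' _ _ h)]

theorem Sub.fill {Γ Δ : Ctx P} (h : Γ.Sub Δ) (G : CtxPat P) : (G.fill Γ).Sub (G.fill Δ) := by
  induction G with
  | hole => exact h
  | seqR Γ G ih => exact (Sub.refl _).seq ih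
  | seqL G Γ ih => exact ih.seq (Sub.refl _)
  | parR Γ G ih => exact (Sub.refl _).par ih
  | parL G Γ ih => exact ih.par (Sub.refl _)

theorem Sub.isEmpty_vert {Γ Δ : Ctx P} (h : Γ.Sub Δ) (hΔ : IsEmpty Δ.Vert) : IsEmpty Γ.Vert := by
  obtain ⟨⟨e, -⟩, -⟩ := sub_iff.1 h
  exact e.isEmpty

theorem seq_sub_right {Γ Δ : Ctx P} (h : IsEmpty Γ.Vert) : (Γ.seq Δ).Sub Δ := by
  refine sub_iff.2 ⟨⟨Equiv.emptySum Γ.Vert Δ.Vert, ?_, ?_⟩, Set.subset_union_right⟩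
  · rintro (v | v)
    exacts [h.elim v, rfl]
  · rintro _ _ (@⟨v, w, h'⟩ | @⟨v, w, h'⟩ | ⟨v, w⟩)
    exacts [h.elim v, h', h.elim v]

@[simp] theorem not_empty_has (b : Binding P) : ¬ (empty : Ctx P).Has b := by simp [Has, count]

@[simp] theorem bind_has (b b' : Binding P) : (bind b).Has b' ↔ b = b' := by
  by_cases h : b = b' <;> simp [Has, count, h]

@[simp] theorem seq_has (Γ Δ : Ctx P) (b : Binding P) : (seq Γ Δ).Has b ↔ Γ.Has b ∨ Δ.Has b := by
  simp [Has, count]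

@[simp] theorem par_has (Γ Δ : Ctx P) (b : Binding P) : (par Γ Δ).Has b ↔ Γ.Has b ∨ Δ.Has b := by
  simp [Has, count]

theorem has_iff {Γ : Ctx P} {b : Binding P} : Γ.Has b ↔ b ∈ Γ.unrSet ∨ ∃ v, Γ.lab v = b := by
  induction Γ with
  | empty => exact ⟨fun h => (not_empty_has b h).elim, by
    rintro (h | ⟨v, -⟩)
    exacts [h.elim, v.elim]⟩
  | bind b' =>
    rw [bind_has]
    constructor
    · rintro rfl
      by_cases h : b'.Unr
      exacts [Or.inl ⟨rfl, h⟩, Or.inr ⟨⟨h⟩, rfl⟩]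
    · rintro (⟨rfl, -⟩ | ⟨-, rfl⟩) <;> rfl
  | seq Γ Δ h₁ h₂ =>
    rw [seq_has, h₁, h₂]
    simp only [unrSet, Set.mem_union, Vert, lab, Sum.exists, Sum.elim_inl, Sum.elim_inr]
    tauto
  | par Γ Δ h₁ h₂ =>
    rw [par_has, h₁, h₂]
    simp only [unrSet, Set.mem_union, Vert, lab, Sum.exists, Sum.elim_inl, Sum.elim_inr]
    tauto

theorem Sub.has {Γ Δ : Ctx P} (h : Γ.Sub Δ) {b : Binding P} (hb : Δ.Has b) : Γ.Has b := by
  obtain ⟨⟨e, hl, -⟩, hu⟩ := sub_iff.1 h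
  rw [has_iff] at hb ⊢
  rcases hb with hb | ⟨v, rfl⟩
  · exact Or.inl (hu hb)
  · exact Or.inr ⟨e.symm v, by rw [← hl, e.apply_symm_apply]⟩

theorem Sub.isRuntime {Γ Δ : Ctx P} (h : Γ.Sub Δ) (hΓ : Γ.IsRuntime) : Δ.IsRuntime :=
  fun x T hx => hΓ x T (h.has hx)

/-! ### Replacing bindings by contexts -/

/-- Replace every binding `b` by the context `σ b`. -/
def expand (σ : Binding P → Ctx P) : Ctx P → Ctx P
  | empty => empty
  | bind b => σ b
  | seq Γ₁ Γ₂ => seq (expand σ Γ₁) (expand σ Γ₂)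
  | par Γ₁ Γ₂ => par (expand σ Γ₁) (expand σ Γ₂)

theorem expand_has {σ : Binding P → Ctx P} {Γ : Ctx P} {b : Binding P} :
    (Γ.expand σ).Has b ↔ ∃ b', Γ.Has b' ∧ (σ b').Has b := by
  induction Γ with
  | empty => simp [expand]
  | bind b' => simp [expand]
  | seq Γ Δ h₁ h₂ => simp [expand, h₁, h₂, or_and_right, exists_or]
  | par Γ Δ h₁ h₂ => simp [expand, h₁, h₂, or_and_right, exists_or]

theorem mem_unrSet_expand {σ : Binding P → Ctx P} {Γ : Ctx P} {b : Binding P} :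
    b ∈ (Γ.expand σ).unrSet ↔ ∃ b', Γ.Has b' ∧ b ∈ (σ b').unrSet := by
  induction Γ with
  | empty => simp [expand, unrSet]
  | bind b' => simp [expand]
  | seq Γ Δ h₁ h₂ => simp [expand, unrSet, h₁, h₂, or_and_right, exists_or]
  | par Γ Δ h₁ h₂ => simp [expand, unrSet, h₁, h₂, or_and_right, exists_or]

/-- Edges between vertices of the same replacement. -/
inductive FiberEdge (σ : Binding P → Ctx P) :
    (Σ b, (σ b).Vert) → (Σ b, (σ b).Vert) → Prop
  | mk (b : Binding P) (v w : (σ b).Vert) (h : (σ b).edge v w) : FiberEdge σ ⟨b, v⟩ ⟨b, w⟩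

/-- The graph of the expansion is a lexicographic composition: a vertex is a vertex `v` of `Γ` with
a vertex of the replacement of its label. The second component ranges over the sigma type of all
replacements, and the range of `φ` is cut out by an equation; thus no transport along equalities of
labels is needed. By `hσ`, unrestricted bindings, which have no vertex in `Γ`, produce none. -/
theorem exists_expand_vert {σ : Binding P → Ctx P} (hσ : ∀ b, b.Unr → IsEmpty (σ b).Vert)
    (Γ : Ctx P) : ∃ φ : (Γ.expand σ).Vert → Γ.Vert × (Σ b, (σ b).Vert),
      Function.Injective φ ∧ (∀ p, (∃ d, φ d = p) ↔ p.2.1 = Γ.lab p.1) ∧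
      (∀ d, (Γ.expand σ).lab d = (σ (φ d).2.1).lab (φ d).2.2) ∧
      ∀ d d', (Γ.expand σ).edge d d' ↔
        Γ.edge (φ d).1 (φ d').1 ∨ (φ d).1 = (φ d').1 ∧ FiberEdge σ (φ d).2 (φ d').2 := by
  induction Γ with
  | empty =>
    exact ⟨fun d => d.elim, fun d => d.elim, fun p => p.1.elim, fun d => d.elim, fun d => d.elim⟩
  | bind b =>
    refine ⟨fun d => ⟨⟨fun hb => (hσ b hb).elim d⟩, b, d⟩, fun d d' h => ?_, fun p => ⟨?_, ?_⟩,
      fun d => rfl, fun d d' => ⟨fun h => Or.inr ⟨rfl, .mk b d d' h⟩, ?_⟩⟩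
    · exact eq_of_heq (Sigma.mk.inj_iff.1 (Prod.ext_iff.1 h).2).2
    · rintro ⟨d, rfl⟩
      rfl
    · obtain ⟨⟨h⟩, b', d⟩ := p
      rintro (rfl : b' = b)
      exact ⟨d, rfl⟩
    · rintro (h | ⟨-, h⟩)
      · exact h.elim
      · cases h with
        | mk _ _ _ h => exact h
  | seq Γ Δ h₁ h₂ =>
    obtain ⟨f, fi, fr, fl, fe⟩ := h₁
    obtain ⟨g, gi, gr, gl, ge⟩ := h₂
    refine ⟨Sum.elim (fun d => ⟨Sum.inl (f d).1, (f d).2⟩) (fun d => ⟨Sum.inr (g d).1, (g d).2⟩),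
      ?_, ?_, ?_, ?_⟩
    · rintro (d | d) (d' | d') h
      · rw [fi (Prod.ext (Sum.inl_injective (Prod.ext_iff.1 h).1) (Prod.ext_iff.1 h).2)]
      · cases congrArg Prod.fst h
      · cases congrArg Prod.fst h
      · rw [gi (Prod.ext (Sum.inr_injective (Prod.ext_iff.1 h).1) (Prod.ext_iff.1 h).2)]
    · rintro ⟨v | v, q⟩
      · refine Iff.trans ⟨?_, ?_⟩ (fr ⟨v, q⟩)
        · rintro ⟨d | d, h⟩
          · exact ⟨d, Prod.ext (Sum.inl_injective (Prod.ext_iff.1 h).1) (Prod.ext_iff.1 h).2⟩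
          · cases congrArg Prod.fst h
        · rintro ⟨d, h⟩
          exact ⟨Sum.inl d, by simp [h]⟩
      · refine Iff.trans ⟨?_, ?_⟩ (gr ⟨v, q⟩)
        · rintro ⟨d | d, h⟩
          · cases congrArg Prod.fst h
          · exact ⟨d, Prod.ext (Sum.inr_injective (Prod.ext_iff.1 h).1) (Prod.ext_iff.1 h).2⟩
        · rintro ⟨d, h⟩
          exact ⟨Sum.inr d, by simp [h]⟩
    · rintro (d | d)
      exacts [fl d, gl d]
    · rintro (d | d) (d' | d') <;> simp [edge, expand, fe, ge, Vert]
  | par Γ Δ h₁ h₂ =>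
    obtain ⟨f, fi, fr, fl, fe⟩ := h₁
    obtain ⟨g, gi, gr, gl, ge⟩ := h₂
    refine ⟨Sum.elim (fun d => ⟨Sum.inl (f d).1, (f d).2⟩) (fun d => ⟨Sum.inr (g d).1, (g d).2⟩),
      ?_, ?_, ?_, ?_⟩
    · rintro (d | d) (d' | d') h
      · rw [fi (Prod.ext (Sum.inl_injective (Prod.ext_iff.1 h).1) (Prod.ext_iff.1 h).2)]
      · cases congrArg Prod.fst h
      · cases congrArg Prod.fst h
      · rw [gi (Prod.ext (Sum.inr_injective (Prod.ext_iff.1 h).1) (Prod.ext_iff.1 h).2)]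
    · rintro ⟨v | v, q⟩
      · refine Iff.trans ⟨?_, ?_⟩ (fr ⟨v, q⟩)
        · rintro ⟨d | d, h⟩
          · exact ⟨d, Prod.ext (Sum.inl_injective (Prod.ext_iff.1 h).1) (Prod.ext_iff.1 h).2⟩
          · cases congrArg Prod.fst h
        · rintro ⟨d, h⟩
          exact ⟨Sum.inl d, by simp [h]⟩
      · refine Iff.trans ⟨?_, ?_⟩ (gr ⟨v, q⟩)
        · rintro ⟨d | d, h⟩
          · cases congrArg Prod.fst h
          · exact ⟨d, Prod.ext (Sum.inr_injective (Prod.ext_iff.1 h).1) (Prod.ext_iff.1 h).2⟩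
        · rintro ⟨d, h⟩
          exact ⟨Sum.inr d, by simp [h]⟩
    · rintro (d | d)
      exacts [fl d, gl d]
    · rintro (d | d) (d' | d') <;> simp [edge, expand, fe, ge, Vert]

/-- This serves both for substitution (`σ` replaces one variable) and for the focus on a location
(`σ` erases the others). The bijection for `Γ ≲ Δ` acts on the first coordinate and fixes the
second, which is possible because it preserves labels. -/
theorem Sub.expand_sub_expand {σ : Binding P → Ctx P} (hσ : ∀ b, b.Unr → IsEmpty (σ b).Vert)
    {Γ Δ : Ctx P} (h : Γ.Sub Δ) : (Γ.expand σ).Sub (Δ.expand σ) := by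
  refine sub_iff.2 ⟨?_, fun b hb => ?_⟩
  · obtain ⟨⟨e, hl, hE⟩, -⟩ := sub_iff.1 h
    obtain ⟨f, fi, fr, fl, fe⟩ := exists_expand_vert hσ Γ
    obtain ⟨g, gi, gr, gl, ge⟩ := exists_expand_vert hσ Δ
    have key : ∀ d, ∃ d', g d' = (e (f d).1, (f d).2) := fun d =>
      (gr _).2 (((fr (f d)).1 ⟨d, rfl⟩).trans (hl _).symm)
    choose k hk using key
    refine ⟨Equiv.ofBijective k ⟨fun d d' h => fi ?_, fun d' => ?_⟩, fun d => ?_, fun d d' h => ?_⟩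
    · have := (hk d).symm.trans ((congrArg g h).trans (hk d'))
      exact Prod.ext (e.injective (Prod.ext_iff.1 this).1) (Prod.ext_iff.1 this).2
    · obtain ⟨d, hd⟩ := (fr (e.symm (g d').1, (g d').2)).2
        (((gr (g d')).1 ⟨d', rfl⟩).trans (by simp [← hl]))
      exact ⟨d, gi (by simp [hk, hd])⟩
    · change (Δ.expand σ).lab (k d) = (Γ.expand σ).lab d
      rw [gl, fl, hk]
    · change (Δ.expand σ).edge (k d) (k d')
      rw [ge, hk, hk]
      rcases (fe d d').1 h with h | ⟨h, h'⟩
      · exact Or.inl (hE _ _ h)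
      · exact Or.inr ⟨congrArg e h, h'⟩
  · rw [mem_unrSet_expand] at hb ⊢
    obtain ⟨b', hb', hb⟩ := hb
    exact ⟨b', h.has hb', hb⟩

end Ctx

/-! ### Unique topological orderings as chains, and the focus on a location -/

namespace Ctx

variable {P : Type u}

open Classical in
/-- The ordered bindings of a context, from left to right. -/
noncomputable def verts : Ctx P → List (Binding P)
  | empty => []
  | bind b => if b.Unr then [] else [b]
  | seq Γ₁ Γ₂ => verts Γ₁ ++ verts Γ₂
  | par Γ₁ Γ₂ => verts Γ₁ ++ verts Γ₂

theorem ofFn_graph_v (Γ : Ctx P) : List.ofFn Γ.graph.v = Γ.verts := by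
  induction Γ with
  | empty => rfl
  | bind b =>
    by_cases hb : b.Unr
    · rw [show (bind b).graph = Graph.nil from if_pos hb, verts, if_pos hb]
      rfl
    · rw [show (bind b).graph = Graph.single b from if_neg hb, verts, if_neg hb]
      rfl
  | seq Γ₁ Γ₂ h₁ h₂ => exact (List.ofFn_fin_append _ _).trans (congrArg₂ _ h₁ h₂)
  | par Γ₁ Γ₂ h₁ h₂ => exact (List.ofFn_fin_append _ _).trans (congrArg₂ _ h₁ h₂)

theorem graph_n_eq_length (Γ : Ctx P) : Γ.graph.n = Γ.verts.length := by
  rw [← ofFn_graph_v, List.length_ofFn]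

theorem verts_eq_nil_iff {Γ : Ctx P} : Γ.verts = [] ↔ IsEmpty Γ.Vert := by
  obtain ⟨e, -⟩ := Γ.graph_represents
  rw [← List.length_eq_zero_iff, ← graph_n_eq_length, ← e.isEmpty_congr]
  exact ⟨fun h => h ▸ Fin.isEmpty, fun h => by_contra fun h' => h.false ⟨0, Nat.pos_of_ne_zero h'⟩⟩

@[simp] theorem verts_bind_loc (l : Loc) (m : P) :
    (bind (Binding.loc l m)).verts = [Binding.loc l m] :=
  if_neg fun h => nomatch h

@[simp] theorem verts_empty : (empty : Ctx P).verts = [] := rfl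

@[simp] theorem verts_seq (Γ Δ : Ctx P) : (seq Γ Δ).verts = Γ.verts ++ Δ.verts := rfl

/-- The vertices of the graph are pairwise comparable. -/
def Chain (Γ : Ctx P) : Prop := ∀ v w : Γ.Vert, v = w ∨ Γ.edge v w ∨ Γ.edge w v

theorem chain_of_verts_eq_nil {Γ : Ctx P} (h : Γ.verts = []) : Γ.Chain :=
  fun v => ((verts_eq_nil_iff.1 h).false v).elim

theorem chain_bind (b : Binding P) : (bind b).Chain :=
  fun v w => Or.inl (Subsingleton.elim (α := PLift (¬ b.Unr)) v w)

theorem chain_seq {Γ Δ : Ctx P} : (seq Γ Δ).Chain ↔ Γ.Chain ∧ Δ.Chain := by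
  simp [Chain, Vert, edge]

/-- No edge joins the two sides of a parallel composition, so one of them has no vertices. -/
theorem chain_par {Γ Δ : Ctx P} :
    (par Γ Δ).Chain ↔ Γ.Chain ∧ Δ.Chain ∧ (Γ.verts = [] ∨ Δ.verts = []) := by
  have : (Γ.verts = [] ∨ Δ.verts = []) ↔ ∀ (_ : Γ.Vert) (_ : Δ.Vert), False := by
    rw [verts_eq_nil_iff, verts_eq_nil_iff, isEmpty_iff, isEmpty_iff]
    grind
  rw [this]
  simp only [Chain, Vert, edge, Sum.forall, Sum.liftRel_inl_inl, Sum.liftRel_inr_inr,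
    Sum.not_liftRel_inl_inr, Sum.not_liftRel_inr_inl, Sum.inl.injEq, Sum.inr.injEq, reduceCtorEq,
    or_self]
  grind

theorem edge_trans (Γ : Ctx P) : ∀ u v w, Γ.edge u v → Γ.edge v w → Γ.edge u w := by
  induction Γ with
  | empty => exact fun u => u.elim
  | bind b => exact fun _ _ _ h => h.elim
  | seq Γ₁ Γ₂ h₁ h₂ =>
    rintro (u | u) (v | v) (w | w) <;> simp only [edge, Sum.lex_inl_inl, Sum.lex_inr_inr,
      Sum.lex_inr_inl, Sum.Lex.sep, IsEmpty.forall_iff, implies_true]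
    exacts [h₁ u v w, h₂ u v w]
  | par Γ₁ Γ₂ h₁ h₂ =>
    rintro (u | u) (v | v) (w | w) <;> simp only [edge, Sum.liftRel_inl_inl, Sum.liftRel_inr_inr,
      Sum.not_liftRel_inl_inr, Sum.not_liftRel_inr_inl, IsEmpty.forall_iff, implies_true]
    exacts [h₁ u v w, h₂ u v w]

theorem graph_E_trans (Γ : Ctx P) {i j k : Fin Γ.graph.n} (h : Γ.graph.E i j)
    (h' : Γ.graph.E j k) : Γ.graph.E i k := by
  obtain ⟨e, -, hE⟩ := Γ.graph_represents
  rw [← hE] at h h' ⊢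
  exact Γ.edge_trans _ _ _ h h'

theorem chain_iff_graph {Γ : Ctx P} : Γ.Chain ↔ ∀ i j, i < j → Γ.graph.E i j := by
  obtain ⟨e, -, hE⟩ := Γ.graph_represents
  constructor
  · intro h i j hij
    rcases h (e i) (e j) with h | h | h
    · exact absurd (e.injective h) hij.ne
    · exact (hE i j).1 h
    · exact absurd (Γ.graph_edge_lt _ _ ((hE j i).1 h)) hij.not_gt
  · intro h v w
    obtain ⟨i, rfl⟩ := e.surjective v
    obtain ⟨j, rfl⟩ := e.surjective w
    rw [hE, hE]
    rcases lt_trichotomy i j with hij | rfl | hij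
    exacts [Or.inr (Or.inl (h _ _ hij)), Or.inl rfl, Or.inr (Or.inr (h _ _ hij))]

theorem isTopOrder_refl (Γ : Ctx P) : Γ.graph.IsTopOrder (Equiv.refl _) := Γ.graph_edge_lt

/-- Edges increase the index, and exchanging two neighbouring positions reverses no other pair. -/
theorem isTopOrder_swap (Γ : Ctx P) {i j : Fin Γ.graph.n} (hij : (i : ℕ) + 1 = j)
    (h : ¬ Γ.graph.E i j) : Γ.graph.IsTopOrder (Equiv.swap i j) := by
  intro a b hab
  have hlt := Γ.graph_edge_lt a b hab
  have hne : ¬ (a = i ∧ b = j) := fun h' => h (h'.1 ▸ h'.2 ▸ hab)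
  rw [Equiv.symm_swap, Equiv.swap_apply_def, Equiv.swap_apply_def]
  simp only [Fin.ext_iff, Fin.lt_def] at *
  split_ifs <;> omega

theorem strictMono_equiv_val {n m : ℕ} (e : Fin n ≃ Fin m) (h : StrictMono e) (i : Fin n) :
    (e i : ℕ) = i :=
  Fin.coe_orderIso_apply (h.orderIsoOfSurjective e e.surjective) i

theorem Chain.isTopOrder_eq_refl {Γ : Ctx P} (h : Γ.Chain) {f : Fin Γ.graph.n ≃ Fin Γ.graph.n}
    (hf : Γ.graph.IsTopOrder f) : f = Equiv.refl _ := by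
  have : f.symm = Equiv.refl _ := Equiv.ext fun i => Fin.ext
    (strictMono_equiv_val f.symm (fun i j hij => hf i j (chain_iff_graph.1 h i j hij)) i)
  rw [← f.symm_symm, this, Equiv.refl_symm]

/-- If two consecutive vertices were not joined by an edge, swapping them would give a second
topological ordering besides the identity. Transitivity extends the edges from consecutive vertices
to all pairs. -/
theorem chain_of_unique {Γ : Ctx P} {f : Fin Γ.graph.n ≃ Fin Γ.graph.n}
    (hf : ∀ g, Γ.graph.IsTopOrder g → g = f) : Γ.Chain := by
  have hsucc : ∀ i j : Fin Γ.graph.n, (i : ℕ) + 1 = j → Γ.graph.E i j := by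
    intro i j hij
    by_contra h
    have hsw := (hf _ (Γ.isTopOrder_swap hij h)).trans (hf _ Γ.isTopOrder_refl).symm
    have := congrArg (fun g : Fin Γ.graph.n ≃ Fin Γ.graph.n => (g i : ℕ)) hsw
    simp only [Equiv.swap_apply_left, Equiv.refl_apply] at this
    omega
  rw [chain_iff_graph]
  rintro ⟨i, hi⟩ ⟨j, hj⟩ (hij : i < j)
  induction j, hij using Nat.le_induction with
  | base => exact hsucc _ _ rfl
  | succ j hij ih =>
    exact Γ.graph_E_trans (ih (Nat.lt_of_succ_lt hj)) (hsucc ⟨j, Nat.lt_of_succ_lt hj⟩ ⟨j + 1, hj⟩ rfl)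

theorem existsUnique_isTopOrder_iff {Γ : Ctx P} :
    (∃! f : Fin Γ.graph.n ≃ Fin Γ.graph.n, Γ.graph.IsTopOrder f) ↔ Γ.Chain :=
  ⟨fun ⟨_, _, h⟩ => chain_of_unique h,
    fun h => ⟨Equiv.refl _, Γ.isTopOrder_refl, fun _ hg => h.isTopOrder_eq_refl hg⟩⟩

theorem hasUsage_iff [OPM P] {Γ : Ctx P} {m : P} :
    Γ.HasUsage m ↔ Γ.Chain ∧ usageOf Γ.verts = some m := by
  rw [← ofFn_graph_v]
  constructor
  · rintro ⟨f, hf, hu, h⟩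
    have hc := chain_of_unique hu
    rw [hc.isTopOrder_eq_refl hf] at h
    exact ⟨hc, h⟩
  · rintro ⟨hc, h⟩
    exact ⟨Equiv.refl _, Γ.isTopOrder_refl, fun _ hg => hc.isTopOrder_eq_refl hg, h⟩

/-- The bijection carries the edges of a total order into a graph whose edges increase the index. It
is therefore strictly monotone on indices, so it fixes positions, and comparability is inherited by
the graph with more edges. -/
theorem Sub.chain_and_verts_eq {Γ Δ : Ctx P} (h : Γ.Sub Δ) (hc : Γ.Chain) :
    Δ.Chain ∧ Γ.verts = Δ.verts := by
  obtain ⟨⟨e, hl, hE⟩, -⟩ := sub_iff.1 h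
  obtain ⟨f, fl, fE⟩ := Γ.graph_represents
  obtain ⟨g, gl, gE⟩ := Δ.graph_represents
  refine ⟨fun v w => ?_, ?_⟩
  · rcases hc (e.symm v) (e.symm w) with h | h | h
    · exact Or.inl (e.symm.injective h)
    · exact Or.inr (Or.inl (by simpa using hE _ _ h))
    · exact Or.inr (Or.inr (by simpa using hE _ _ h))
  · let k : Fin Γ.graph.n ≃ Fin Δ.graph.n := f.trans (e.trans g.symm)
    have hk : ∀ i, (k i : ℕ) = i := strictMono_equiv_val k fun i j hij => by
      refine Δ.graph_edge_lt _ _ ((gE _ _).1 ?_)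
      simpa [k] using hE _ _ ((fE i j).2 (chain_iff_graph.1 hc i j hij))
    rw [← ofFn_graph_v, ← ofFn_graph_v]
    refine List.ext_getElem (by simpa using Fin.equiv_iff_eq.1 ⟨k⟩) fun i h₁ h₂ => ?_
    simp only [List.getElem_ofFn]
    rw [← fl, ← gl, ← hl]
    congr 1
    rw [← g.symm_apply_eq]
    exact Fin.ext (hk _)

theorem focus_eq_expand (l : Loc) (Γ : Ctx P) :
    Γ.focus l = Γ.expand fun b => (bind b).focus l := by
  induction Γ with
  | empty => rfl
  | bind b => rfl
  | seq Γ Δ h₁ h₂ => simp only [focus, expand, ← h₁, ← h₂]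
  | par Γ Δ h₁ h₂ => simp only [focus, expand, ← h₁, ← h₂]

theorem focus_bind_loc_self (l : Loc) (m : P) :
    (bind (Binding.loc l m)).focus l = bind (Binding.loc l m) :=
  if_pos rfl

theorem focus_bind_loc_of_ne {l l' : Loc} (h : l' ≠ l) (m : P) :
    (bind (Binding.loc l m)).focus l' = empty :=
  if_neg h.symm

theorem Sub.focus {Γ Δ : Ctx P} (h : Γ.Sub Δ) (l : Loc) : (Γ.focus l).Sub (Δ.focus l) := by
  rw [focus_eq_expand, focus_eq_expand l Δ]
  refine h.expand_sub_expand fun b hb => ?_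
  cases b with
  | var x T => exact ⟨fun v => v.down hb⟩
  | loc l' m => nomatch hb

theorem focus_verts_eq_nil {Γ : Ctx P} (h : Γ.verts = []) (l : Loc) : (Γ.focus l).verts = [] := by
  induction Γ with
  | empty => rfl
  | bind b =>
    cases b with
    | var x T => exact h
    | loc l' m => simp at h
  | seq Γ Δ h₁ h₂ =>
    simp only [verts, focus, List.append_eq_nil_iff] at h ⊢
    exact ⟨h₁ h.1, h₂ h.2⟩
  | par Γ Δ h₁ h₂ =>
    simp only [verts, focus, List.append_eq_nil_iff] at h ⊢
    exact ⟨h₁ h.1, h₂ h.2⟩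

@[simp] theorem isRuntime_empty : (empty : Ctx P).IsRuntime := fun _ _ h => not_empty_has _ h

@[simp] theorem isRuntime_bind_loc (l : Loc) (m : P) : (bind (Binding.loc l m)).IsRuntime :=
  fun _ _ h => nomatch (bind_has _ _).1 h

theorem isRuntime_seq {Γ Δ : Ctx P} : (seq Γ Δ).IsRuntime ↔ Γ.IsRuntime ∧ Δ.IsRuntime := by
  simp only [IsRuntime, seq_has, not_or, forall_and]

theorem isRuntime_par {Γ Δ : Ctx P} : (par Γ Δ).IsRuntime ↔ Γ.IsRuntime ∧ Δ.IsRuntime := by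
  simp only [IsRuntime, par_has, not_or, forall_and]

/-- Resource types are ordered, so every binding of `l` is a vertex. The focus does not erase
variables; excluding them is the role of `hC`. -/
theorem loc_mem_dom_iff {C : Ctx P} (hC : C.IsRuntime) (l : Loc) :
    Name.loc l ∈ C.dom ↔ (C.focus l).verts ≠ [] := by
  have key : Name.loc l ∈ C.dom ↔ ∃ m, C.Has (Binding.loc l m) := by
    constructor
    · rintro ⟨b | ⟨l', m⟩, hb, h⟩
      · nomatch h
      · cases h
        exact ⟨m, hb⟩
    · rintro ⟨m, hm⟩
      exact ⟨_, hm, rfl⟩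
  rw [key]
  clear key
  induction C with
  | empty => simp [focus]
  | bind b =>
    cases b with
    | var x T => exact absurd ((bind_has _ _).2 rfl) (hC x T)
    | loc l' m => by_cases h : l' = l <;> simp [focus, h]
  | seq Γ Δ h₁ h₂ =>
    rw [isRuntime_seq] at hC
    simp only [seq_has, exists_or, h₁ hC.1, h₂ hC.2, focus, verts, ne_eq, List.append_eq_nil_iff]
    tauto
  | par Γ Δ h₁ h₂ =>
    rw [isRuntime_par] at hC
    simp only [par_has, exists_or, h₁ hC.1, h₂ hC.2, focus, verts, ne_eq, List.append_eq_nil_iff]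
    tauto

/-! ### Heap typing, one location at a time -/

/-- The condition that heap typing imposes on the focus on a location and its heap entry. -/
def Fits [OPM P] (Γ : Ctx P) : Option (Cell P) → Prop
  | none => Γ.verts = []
  | some c => Γ.Chain ∧ Γ.verts.length = c.refs + 1 ∧
      ∃ u, usageOf Γ.verts = some u ∧ MulLe c.trace u c.spec

theorem typesHeap_iff [OPM P] {C : Ctx P} (hC : C.IsRuntime) {H : Heap P} :
    C.TypesHeap H ↔ ∀ l, (C.focus l).Fits (H.lookup l) := by
  constructor
  · rintro ⟨ho, hd, hu⟩ l
    cases hl : H.lookup l with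
    | none =>
      by_contra hne
      have := (loc_mem_dom_iff hC l).2 hne
      rw [hd] at this
      obtain ⟨l', hl', h⟩ := this
      cases h
      exact Finmap.lookup_eq_none.1 hl hl'
    | some c =>
      obtain ⟨hn, u, h, hle⟩ := hu l c hl
      rw [hasUsage_iff] at h
      exact ⟨h.1, by rw [← graph_n_eq_length, hn], u, h.2, hle⟩
  · intro h
    refine ⟨fun l => ?_, ?_, fun l c hl => ?_⟩
    · rw [existsUnique_isTopOrder_iff]
      have := h l
      cases hl : H.lookup l with
      | none =>
        rw [hl] at this
        exact chain_of_verts_eq_nil this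
      | some c =>
        rw [hl] at this
        exact this.1
    · have key : ∀ l, Name.loc l ∈ C.dom ↔ l ∈ H := by
        intro l
        rw [loc_mem_dom_iff hC, ← not_iff_not, ← Finmap.lookup_eq_none, not_not]
        have := h l
        cases hl : H.lookup l with
        | none =>
          rw [hl] at this
          exact iff_of_true this rfl
        | some c =>
          rw [hl] at this
          refine iff_of_false (fun h' => ?_) (by simp)
          have := this.2.1
          simp [h'] at this
      ext x
      cases x with
      | var x =>
        refine iff_of_false ?_ (fun ⟨_, _, h⟩ => nomatch h)
        rintro ⟨⟨x, T⟩ | _, hb, h⟩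
        exacts [hC _ _ hb, nomatch h]
      | loc l =>
        rw [key]
        exact ⟨fun h => ⟨l, h, rfl⟩, fun ⟨_, h, h'⟩ => by cases h'; exact h⟩
    · have := h l
      rw [hl] at this
      obtain ⟨hc, hn, u, hu, hle⟩ := this
      exact ⟨by rw [graph_n_eq_length, hn], u, hasUsage_iff.2 ⟨hc, hu⟩, hle⟩

theorem Fits.mono [OPM P] {Γ Δ : Ctx P} {o : Option (Cell P)} (h : Γ.Fits o) (hs : Γ.Sub Δ) :
    Δ.Fits o := by
  cases o with
  | none =>
    rw [Fits, ← (hs.chain_and_verts_eq (chain_of_verts_eq_nil h)).2]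
    exact h
  | some c =>
    obtain ⟨hc, h⟩ := h
    obtain ⟨hc', hv⟩ := hs.chain_and_verts_eq hc
    rw [hv] at h
    exact ⟨hc', h⟩

/-- This allows the weakenings of a typing derivation to be absorbed: inversion yields a larger
context, which still types the heap. -/
theorem TypesHeap.mono [OPM P] {C D : Ctx P} {H : Heap P} (h : C.TypesHeap H)
    (hC : C.IsRuntime) (hs : C.Sub D) : D.TypesHeap H :=
  (typesHeap_iff (hs.isRuntime hC)).2 fun l => ((typesHeap_iff hC).1 h l).mono (hs.focus l)

end Ctx

/-! ### Chains inside context patterns, and holes that no ordered binding precedes -/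

namespace CtxPat

variable {P : Type u}

/-- The ordered bindings to the left of the hole. -/
noncomputable def pre : CtxPat P → List (Binding P)
  | hole => []
  | seqR Γ G => Γ.verts ++ pre G
  | seqL G _ => pre G
  | parR Γ G => Γ.verts ++ pre G
  | parL G _ => pre G

/-- The ordered bindings to the right of the hole. -/
noncomputable def post : CtxPat P → List (Binding P)
  | hole => []
  | seqR _ G => post G
  | seqL G Γ => post G ++ Γ.verts
  | parR _ G => post G
  | parL G Γ => post G ++ Γ.verts

theorem fill_verts (G : CtxPat P) (Δ : Ctx P) :
    (G.fill Δ).verts = G.pre ++ Δ.verts ++ G.post := by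
  induction G <;> simp_all [fill, Ctx.verts, pre, post]

/-- The condition `hv` is needed for parallel patterns: a context parallel to an empty hole may have
vertices, and then the hole must stay empty. -/
theorem chain_fill (G : CtxPat P) {Δ Δ' : Ctx P} (h : (G.fill Δ).Chain) (h' : Δ'.Chain)
    (hv : Δ.verts = [] → Δ'.verts = []) : (G.fill Δ').Chain := by
  have key (G : CtxPat P) (h : (G.fill Δ).verts = []) : (G.fill Δ').verts = [] := by
    simp only [fill_verts, List.append_eq_nil_iff] at h ⊢
    exact ⟨⟨h.1.1, hv h.1.2⟩, h.2⟩
  induction G with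
  | hole => exact h'
  | seqR Γ G ih =>
    rw [fill, Ctx.chain_seq] at h ⊢
    exact ⟨h.1, ih h.2⟩
  | seqL G Γ ih =>
    rw [fill, Ctx.chain_seq] at h ⊢
    exact ⟨ih h.1, h.2⟩
  | parR Γ G ih =>
    rw [fill, Ctx.chain_par] at h ⊢
    exact ⟨h.1, ih h.2.1, h.2.2.imp id (key G)⟩
  | parL G Γ ih =>
    rw [fill, Ctx.chain_par] at h ⊢
    exact ⟨ih h.1, h.2.1, h.2.2.imp (key G) id⟩

/-- Replace all bindings of locations other than `l` by the empty context. -/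
def focus (l : Loc) : CtxPat P → CtxPat P
  | hole => hole
  | seqR Γ G => seqR (Γ.focus l) (focus l G)
  | seqL G Γ => seqL (focus l G) (Γ.focus l)
  | parR Γ G => parR (Γ.focus l) (focus l G)
  | parL G Γ => parL (focus l G) (Γ.focus l)

theorem fill_focus (G : CtxPat P) (Δ : Ctx P) (l : Loc) :
    (G.fill Δ).focus l = (G.focus l).fill (Δ.focus l) := by
  induction G <;> simp_all [fill, focus, Ctx.focus]

/-- No ordered binding precedes the hole. -/
def Lead : CtxPat P → Prop
  | hole => True
  | seqR Γ G => Γ.verts = [] ∧ Lead G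
  | seqL G _ => Lead G
  | parR _ G => Lead G
  | parL G _ => Lead G

theorem Lead.focus {G : CtxPat P} (h : G.Lead) (l : Loc) : (G.focus l).Lead := by
  induction G with
  | hole => trivial
  | seqR Γ G ih => exact ⟨Ctx.focus_verts_eq_nil h.1 l, ih h.2⟩
  | seqL G Γ ih => exact ih h
  | parR Γ G ih => exact ih h
  | parL G Γ ih => exact ih h

/-- `Lead` does not restrict contexts parallel to the hole. In a chain with a nonempty hole these
have no vertices. -/
theorem Lead.pre_eq_nil {G : CtxPat P} (h : G.Lead) {Δ : Ctx P} (hc : (G.fill Δ).Chain)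
    (hΔ : Δ.verts ≠ []) : G.pre = [] := by
  have key (G : CtxPat P) : (G.fill Δ).verts ≠ [] := fun h => by
    simp only [fill_verts, List.append_eq_nil_iff] at h
    exact hΔ h.1.2
  induction G with
  | hole => rfl
  | seqR Γ G ih =>
    rw [fill, Ctx.chain_seq] at hc
    rw [pre, h.1, ih h.2 hc.2, List.append_nil]
  | seqL G Γ ih =>
    rw [fill, Ctx.chain_seq] at hc
    exact ih h hc.1
  | parR Γ G ih =>
    rw [fill, Ctx.chain_par] at hc
    rw [pre, hc.2.2.resolve_right (key G), ih h hc.2.1, List.append_nil]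
  | parL G Γ ih =>
    rw [fill, Ctx.chain_par] at hc
    exact ih h hc.1

theorem isRuntime_fill {G : CtxPat P} {Δ : Ctx P} :
    (G.fill Δ).IsRuntime ↔ (G.fill Ctx.empty).IsRuntime ∧ Δ.IsRuntime := by
  induction G with
  | hole => simp [fill]
  | seqR Γ G ih => simp only [fill, Ctx.isRuntime_seq]; rw [ih, and_assoc]
  | seqL G Γ ih => simp only [fill, Ctx.isRuntime_seq]; rw [ih, and_right_comm]
  | parR Γ G ih => simp only [fill, Ctx.isRuntime_par]; rw [ih, and_assoc]
  | parL G Γ ih => simp only [fill, Ctx.isRuntime_par]; rw [ih, and_right_comm]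

end CtxPat

/-! ### Usages, and the effect of each heap operation at its location -/

namespace Ctx

variable {P : Type u} [OPM P]

theorem usageOf_append (a b : List (Binding P)) :
    usageOf (a ++ b) = (usageOf a).bind fun p => (usageOf b).bind fun q => OPM.mul p q := by
  induction a with
  | nil =>
    cases h : usageOf b <;> simp [usageOf, h, OPM.eps_mul]
  | cons c a ih =>
    cases c with
    | var x T => rfl
    | loc l m =>
      rw [List.cons_append, usageOf, usageOf, ih]
      cases usageOf a with
      | none => rfl
      | some p =>
        cases usageOf b with
        | none => simp
        | some q => simpa using (OPM.mul_assoc m p q).symm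

/-- Monotonicity applied on both sides of the segment; it also supplies definedness of the new
product. Dropping (`b'` empty) and splitting (`b'` of length two) are instances. -/
theorem exists_usageOf_le {a b b' c : List (Binding P)} {u q q' : P}
    (h : usageOf (a ++ b ++ c) = some u) (hb : usageOf b = some q) (hb' : usageOf b' = some q')
    (hle : q' ≤ q) : ∃ u', usageOf (a ++ b' ++ c) = some u' ∧ u' ≤ u := by
  rw [usageOf_append, usageOf_append, hb] at h
  rw [usageOf_append, usageOf_append, hb']
  simp only [Option.bind_eq_some_iff, Option.bind_some] at h ⊢
  obtain ⟨pq, ⟨p, hp, hpq⟩, r, hr, hu⟩ := h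
  obtain ⟨pq', hpq', hle'⟩ := OPM.mul_mono p p q' q pq le_rfl hle hpq
  obtain ⟨u', hu', hle''⟩ := OPM.mul_mono pq' pq r r u hle' le_rfl hu
  exact ⟨u', ⟨pq', ⟨p, hp, hpq'⟩, r, hr, hu'⟩, hle''⟩

theorem usageOf_loc (l : Loc) (m : P) : usageOf [Binding.loc l m] = some m := by
  simp [usageOf, OPM.mul_eps]

theorem _root_.OrdBorrow.MulLe.mono {m n n' k : P} (h : MulLe m n k) (hn : n' ≤ n) :
    MulLe m n' k := by
  obtain ⟨p, hp, hle⟩ := h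
  obtain ⟨p', hp', hle'⟩ := OPM.mul_mono m m n' n p le_rfl hn hp
  exact ⟨p', hp', hle'.trans hle⟩

namespace Fits

variable {G : CtxPat P} {Δ Δ' : Ctx P} {l : Loc} {m m₁ m₂ s t p : P} {n : ℕ}

/-- Covers the locations that a step does not touch: their focus is empty in the hole before and
after. -/
theorem fill_of_verts_eq_nil {o : Option (Cell P)} (h : (G.fill Δ).Fits o) (hΔ : Δ.verts = [])
    (hΔ' : Δ'.verts = []) : (G.fill Δ').Fits o := by
  have hv : (G.fill Δ').verts = (G.fill Δ).verts := by
    rw [G.fill_verts, G.fill_verts, hΔ, hΔ']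
  cases o with
  | none => exact hv.trans h
  | some c =>
    obtain ⟨hc, h⟩ := h
    rw [← hv] at h
    exact ⟨G.chain_fill hc (chain_of_verts_eq_nil hΔ') fun _ => hΔ', h⟩

theorem new (h : (G.fill Δ).Fits none) :
    (G.fill (bind (Binding.loc l m))).Fits (some ⟨0, m, OPM.eps⟩) := by
  have h' : G.pre = [] ∧ Δ.verts = [] ∧ G.post = [] := by
    simpa [Fits, G.fill_verts] using h
  have hv : (G.fill (bind (Binding.loc l m))).verts = [Binding.loc l m] := by
    simp [G.fill_verts, h']
  refine ⟨?_, by simp [hv], m, by rw [hv, usageOf_loc], m, OPM.eps_mul m, le_rfl⟩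
  rw [chain_iff_graph]
  have hn := (G.fill (bind (Binding.loc l m))).graph_n_eq_length
  rw [hv, List.length_singleton] at hn
  intro i j hij
  omega

/-- With no binding before the hole the usage is `m ⊙ r`, where `r` is the usage of the bindings
after it. From `m₁ ⊙ m₂ ≤ m` follows `t ⊙ ((m₁ ⊙ m₂) ⊙ r) ≤ s`, and reassociation makes this `(t ⊙
m₁) ⊙ (m₂ ⊙ r) ≤ s`. -/
theorem op (h : (G.fill (bind (Binding.loc l m))).Fits (some ⟨n, s, t⟩)) (hG : G.Lead)
    (hm : MulLe m₁ m₂ m) (hp : OPM.mul t m₁ = some p) :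
    (G.fill (bind (Binding.loc l m₂))).Fits (some ⟨n, s, p⟩) := by
  obtain ⟨hc, hn, u, hu, hle⟩ := h
  have hpre := hG.pre_eq_nil hc (by simp)
  refine ⟨G.chain_fill hc (chain_bind _) (by simp), ?_, ?_⟩
  · simpa [G.fill_verts] using hn
  · obtain ⟨k, hk, hkm⟩ := hm
    simp only [G.fill_verts, verts_bind_loc, hpre, List.nil_append, List.singleton_append, usageOf,
      Option.bind_eq_some_iff] at hu ⊢
    obtain ⟨r, hr, hu⟩ := hu
    obtain ⟨v, hv, hvu⟩ := OPM.mul_mono k m r r u hkm le_rfl hu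
    obtain ⟨w, hw, hws⟩ := hle.mono hvu
    -- Associativity of the partial product also shows that `q = m₂ ⊙ r` is defined.
    have h₁ := OPM.mul_assoc m₁ m₂ r
    rw [hk, Option.bind_some, hv, eq_comm, Option.bind_eq_some_iff] at h₁
    obtain ⟨q, hq, hq'⟩ := h₁
    have h₂ := OPM.mul_assoc t m₁ q
    rw [hp, hq', Option.bind_some, Option.bind_some] at h₂
    exact ⟨q, ⟨r, hr, hq⟩, w, h₂.trans hw, hws⟩

theorem drop_usage (h : usageOf (G.fill (bind (Binding.loc l m))).verts = some p)
    (hm : OPM.eps ≤ m) : ∃ q, usageOf (G.fill empty).verts = some q ∧ q ≤ p := by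
  rw [G.fill_verts, verts_bind_loc] at h
  rw [G.fill_verts]
  exact exists_usageOf_le h (usageOf_loc l m) rfl hm

theorem drop_succ (h : (G.fill (bind (Binding.loc l m))).Fits (some ⟨n + 1, s, t⟩))
    (hm : OPM.eps ≤ m) : (G.fill empty).Fits (some ⟨n, s, t⟩) := by
  obtain ⟨hc, hn, u, hu, hle⟩ := h
  obtain ⟨q, hq, hqu⟩ := drop_usage hu hm
  refine ⟨G.chain_fill hc (chain_of_verts_eq_nil rfl) fun _ => rfl, ?_, q, hq, hle.mono hqu⟩
  simp only [G.fill_verts, verts_bind_loc, List.length_append, List.length_singleton,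
    verts_empty, List.length_nil] at hn ⊢
  omega

/-- Reference count `0` stands for exactly one vertex, and that one is in the hole. -/
theorem drop_zero (h : (G.fill (bind (Binding.loc l m))).Fits (some ⟨0, s, t⟩)) :
    (G.fill empty).Fits none := by
  obtain ⟨-, hn, -⟩ := h
  simp only [G.fill_verts, verts_bind_loc, List.length_append, List.length_singleton] at hn
  simp only [Fits, G.fill_verts, verts_empty, List.append_nil, ← List.length_eq_zero_iff,
    List.length_append]
  omega

theorem split (h : (G.fill (bind (Binding.loc l m))).Fits (some ⟨n, s, t⟩))
    (hm : MulLe m₁ m₂ m) :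
    (G.fill (seq (bind (Binding.loc l m₁)) (bind (Binding.loc l m₂)))).Fits
      (some ⟨n + 1, s, t⟩) := by
  obtain ⟨hc, hn, u, hu, hle⟩ := h
  obtain ⟨k, hk, hkm⟩ := hm
  refine ⟨G.chain_fill hc (chain_seq.2 ⟨chain_bind _, chain_bind _⟩) (by simp), ?_, ?_⟩
  · simp only [G.fill_verts, verts_bind_loc, List.length_append, List.length_singleton,
      verts_seq] at hn ⊢
    omega
  · rw [G.fill_verts, verts_bind_loc] at hu
    obtain ⟨u', hu', hle'⟩ := exists_usageOf_le (b' := [Binding.loc l m₁, Binding.loc l m₂]) hu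
      (usageOf_loc l m) (q' := k) (by simp [usageOf, OPM.mul_eps, hk]) hkm
    refine ⟨u', ?_, hle.mono hle'⟩
    simpa [G.fill_verts] using hu'

end Fits

end Ctx

/-! ### Locally closed expressions and substitution for free variables -/

namespace Expr

variable {P : Type u}

/-- All bound variables have indices below `k`. -/
def LcAt : ℕ → Expr P → Prop
  | _, const _ => True
  | _, loc _ => True
  | _, fvar _ => True
  | k, bvar i => i < k
  | k, lam _ M => LcAt (k + 1) M
  | k, app _ M N => LcAt k M ∧ LcAt k N
  | k, upair M N => LcAt k M ∧ LcAt k N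
  | k, opair M N => LcAt k M ∧ LcAt k N
  | k, ulet M N => LcAt k M ∧ LcAt (k + 2) N
  | k, olet M N => LcAt k M ∧ LcAt (k + 2) N

/-- Replace the free variable `x` by `V`. -/
def substVar (M : Expr P) (x : Var) (V : Expr P) : Expr P :=
  match M with
  | const c => const c
  | loc l => loc l
  | fvar y => if y = x then V else fvar y
  | bvar i => bvar i
  | lam a M => lam a (M.substVar x V)
  | app a M N => app a (M.substVar x V) (N.substVar x V)
  | upair M N => upair (M.substVar x V) (N.substVar x V)
  | opair M N => opair (M.substVar x V) (N.substVar x V)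
  | ulet M N => ulet (M.substVar x V) (N.substVar x V)
  | olet M N => olet (M.substVar x V) (N.substVar x V)

theorem LcAt.mono {M : Expr P} {j k : ℕ} (h : LcAt j M) (hjk : j ≤ k) : LcAt k M := by
  induction M generalizing j k with
  | const c => trivial
  | loc l => trivial
  | fvar x => trivial
  | bvar i => exact lt_of_lt_of_le h hjk
  | lam a M ih => exact ih h (by omega)
  | app a M N ih ih' => exact ⟨ih h.1 hjk, ih' h.2 hjk⟩
  | upair M N ih ih' => exact ⟨ih h.1 hjk, ih' h.2 hjk⟩
  | opair M N ih ih' => exact ⟨ih h.1 hjk, ih' h.2 hjk⟩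
  | ulet M N ih ih' => exact ⟨ih h.1 hjk, ih' h.2 (by omega)⟩
  | olet M N ih ih' => exact ⟨ih h.1 hjk, ih' h.2 (by omega)⟩

theorem LcAt.openAt_eq {M : Expr P} {k : ℕ} (h : LcAt k M) (U : Expr P) : openAt k U M = M := by
  induction M generalizing k with
  | bvar i => exact if_neg (Nat.ne_of_lt h)
  | _ => simp_all [openAt, LcAt]

theorem LcAt.of_openAt {M U : Expr P} {k : ℕ} (h : LcAt k (openAt k U M)) : LcAt (k + 1) M := by
  induction M generalizing k with
  | bvar i =>
    by_cases hi : i = k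
    · exact Nat.lt_succ_of_le hi.le
    · rw [openAt, if_neg hi] at h
      exact h.mono k.le_succ
  | const c => trivial
  | loc l => trivial
  | fvar x => trivial
  | lam a M ih => exact ih h
  | app a M N ih ih' => exact ⟨ih h.1, ih' h.2⟩
  | upair M N ih ih' => exact ⟨ih h.1, ih' h.2⟩
  | opair M N ih ih' => exact ⟨ih h.1, ih' h.2⟩
  | ulet M N ih ih' => exact ⟨ih h.1, ih' h.2⟩
  | olet M N ih ih' => exact ⟨ih h.1, ih' h.2⟩

theorem LcAt.of_open2 {M U W : Expr P} (h : LcAt 0 (open2 U W M)) : LcAt 2 M :=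
  h.of_openAt.of_openAt

theorem fv_subset_fv_openAt (M U : Expr P) (k : ℕ) : M.fv ⊆ (openAt k U M).fv := by
  induction M generalizing k with
  | bvar i => simp [fv]
  | lam a M ih => exact ih _
  | app a M N ih ih' => exact Finset.union_subset_union (ih _) (ih' _)
  | upair M N ih ih' => exact Finset.union_subset_union (ih _) (ih' _)
  | opair M N ih ih' => exact Finset.union_subset_union (ih _) (ih' _)
  | ulet M N ih ih' => exact Finset.union_subset_union (ih _) (ih' _)
  | olet M N ih ih' => exact Finset.union_subset_union (ih _) (ih' _)
  | _ => exact subset_rfl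

theorem subst_eq_self {x : Var} {M : Expr P} (h : x ∉ M.fv) (V : Expr P) : M.substVar x V = M := by
  induction M with
  | fvar y => exact if_neg fun hy : y = x => h (by simp [fv, hy])
  | _ => simp_all [substVar, fv]

theorem fv_subst_subset (x : Var) (V M : Expr P) : (M.substVar x V).fv ⊆ M.fv ∪ V.fv := by
  induction M with
  | fvar y => by_cases h : y = x <;> simp [substVar, fv, h]
  | lam a M ih => exact ih
  | const c => simp [substVar, fv]
  | loc l => simp [substVar, fv]
  | bvar i => simp [substVar, fv]
  | _ => simp only [substVar, fv] at *; grind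

/-- Local closure of `V` ensures that opening at `k` does not change the copies of `V` put in by the
substitution. -/
theorem subst_openAt {x : Var} {V : Expr P} (hV : LcAt 0 V) (U M : Expr P) (k : ℕ) :
    (openAt k U M).substVar x V = openAt k (U.substVar x V) (M.substVar x V) := by
  induction M generalizing k with
  | fvar y =>
    by_cases h : y = x
    · simp only [openAt, substVar, if_pos h]
      exact ((hV.mono k.zero_le).openAt_eq _).symm
    · simp [openAt, substVar, h]
  | bvar i => by_cases h : i = k <;> simp [openAt, substVar, h]
  | _ => simp_all [openAt, substVar]

theorem subst_openAt_fvar_self {x : Var} {V M : Expr P} (hV : LcAt 0 V) (hx : x ∉ M.fv) (k : ℕ) :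
    (openAt k (fvar x) M).substVar x V = openAt k V M := by
  rw [subst_openAt hV, subst_eq_self hx, substVar, if_pos rfl]

theorem subst_openAt_fvar_ne {x y : Var} {V : Expr P} (hV : LcAt 0 V) (hxy : y ≠ x) (M : Expr P)
    (k : ℕ) : (openAt k (fvar y) M).substVar x V = openAt k (fvar y) (M.substVar x V) := by
  rw [subst_openAt hV, substVar, if_neg hxy]

theorem subst_open2_fvar_ne {x y z : Var} {V : Expr P} (hV : LcAt 0 V) (hy : y ≠ x) (hz : z ≠ x)
    (M : Expr P) :
    (open2 (fvar y) (fvar z) M).substVar x V = open2 (fvar y) (fvar z) (M.substVar x V) := by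
  rw [open2, subst_openAt_fvar_ne hV hz, subst_openAt_fvar_ne hV hy, open2]

/-- Simultaneous opening is recovered from two successive substitutions; the second leaves `V` alone
because `y` is not free in it. -/
theorem subst_subst_open2 {x y : Var} {V W M : Expr P} (hV : LcAt 0 V) (hW : LcAt 0 W)
    (hxy : x ≠ y) (hx : x ∉ M.fv) (hy : y ∉ M.fv) (hyV : y ∉ V.fv) :
    ((open2 (fvar x) (fvar y) M).substVar x V).substVar y W = open2 V W M := by
  rw [open2, subst_openAt_fvar_ne hV hxy.symm, subst_openAt_fvar_self hV hx, subst_openAt hW,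
    subst_openAt hW, subst_eq_self hyV, subst_eq_self hy, substVar, if_pos rfl, open2]

end Expr

/-! ### Replacing a variable binding by a run-time context -/

namespace Ctx

variable {P : Type u}

theorem mem_dom_var {Γ : Ctx P} {x : Var} :
    Name.var x ∈ Γ.dom ↔ ∃ T, Γ.Has (Binding.var x T) := by
  constructor
  · rintro ⟨⟨y, T⟩ | _, hb, h⟩
    · cases h
      exact ⟨T, hb⟩
    · nomatch h
  · rintro ⟨T, h⟩
    exact ⟨_, h, rfl⟩

theorem IsRuntime.var_notMem_dom {Γ : Ctx P} (h : Γ.IsRuntime) (x : Var) :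
    Name.var x ∉ Γ.dom := fun hx => by
  obtain ⟨T, hT⟩ := mem_dom_var.1 hx
  exact h x T hT

theorem IsRuntime.count_eq_zero {Γ : Ctx P} (h : Γ.IsRuntime) (x : Var) (T : Ty P) :
    Γ.count (Binding.var x T) = 0 := Nat.eq_zero_of_not_pos (h x T)

theorem IsRuntime.wf {Γ : Ctx P} (h : Γ.IsRuntime) : Γ.WF :=
  ⟨fun x S _ hS => absurd hS (h x S), fun x T _ => by simp [h.count_eq_zero]⟩

theorem _root_.OrdBorrow.CtxPat.fill_has (G : CtxPat P) (Γ : Ctx P) (b : Binding P) :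
    (G.fill Γ).Has b ↔ (G.fill empty).Has b ∨ Γ.Has b := by
  induction G with
  | hole => simp [CtxPat.fill]
  | seqR Δ G ih => simp only [CtxPat.fill, seq_has]; rw [ih]; tauto
  | seqL G Δ ih => simp only [CtxPat.fill, seq_has]; rw [ih]; tauto
  | parR Δ G ih => simp only [CtxPat.fill, par_has]; rw [ih]; tauto
  | parL G Δ ih => simp only [CtxPat.fill, par_has]; rw [ih]; tauto

open Classical in
/-- The replacement of `x : S` by `Δ`. -/
noncomputable def single (x : Var) (S : Ty P) (Δ : Ctx P) (b : Binding P) : Ctx P :=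
  if b = Binding.var x S then Δ else bind b

theorem single_self (x : Var) (S : Ty P) (Δ : Ctx P) : single x S Δ (Binding.var x S) = Δ :=
  if_pos rfl

theorem single_of_ne {x y : Var} (h : y ≠ x) (S T : Ty P) (Δ : Ctx P) :
    single x S Δ (Binding.var y T) = bind (Binding.var y T) :=
  if_neg fun h' => h (Binding.var.inj h').1

theorem expand_single_eq_self {x : Var} {Γ : Ctx P} (h : Name.var x ∉ Γ.dom) (S : Ty P)
    (Δ : Ctx P) : Γ.expand (single x S Δ) = Γ := by
  rw [mem_dom_var, not_exists] at h
  induction Γ with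
  | empty => rfl
  | bind b => exact if_neg fun hb => h S ((bind_has _ _).2 hb)
  | seq Γ Γ' h₁ h₂ =>
    simp only [seq_has, not_or] at h
    rw [expand, h₁ fun T => (h T).1, h₂ fun T => (h T).2]
  | par Γ Γ' h₁ h₂ =>
    simp only [par_has, not_or] at h
    rw [expand, h₁ fun T => (h T).1, h₂ fun T => (h T).2]

/-- A run-time context contributes no variable bindings. Hence well-formedness and freshness of
names survive the replacement, even if `Δ` is copied many times. -/
theorem expand_single_count_le {Δ : Ctx P} (hΔ : Δ.IsRuntime) (x y : Var) (S T : Ty P)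
    (Γ : Ctx P) : (Γ.expand (single x S Δ)).count (Binding.var y T) ≤ Γ.count (Binding.var y T) := by
  induction Γ with
  | empty => exact le_rfl
  | bind b =>
    by_cases h : b = Binding.var x S
    · rw [expand, single, if_pos h, hΔ.count_eq_zero]
      exact Nat.zero_le _
    · rw [expand, single, if_neg h]
  | seq Γ Γ' h₁ h₂ => exact Nat.add_le_add h₁ h₂
  | par Γ Γ' h₁ h₂ => exact Nat.add_le_add h₁ h₂

theorem has_of_expand_single {Δ Γ : Ctx P} (hΔ : Δ.IsRuntime) {x y : Var} {S T : Ty P}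
    (h : (Γ.expand (single x S Δ)).Has (Binding.var y T)) : Γ.Has (Binding.var y T) :=
  lt_of_lt_of_le h (expand_single_count_le hΔ x y S T Γ)

theorem WF.expand_single {Γ Δ : Ctx P} (h : Γ.WF) (hΔ : Δ.IsRuntime) (x : Var) (S : Ty P) :
    (Γ.expand (single x S Δ)).WF :=
  ⟨fun y T T' hT hT' => h.1 y T T' (has_of_expand_single hΔ hT) (has_of_expand_single hΔ hT'),
    fun y T hT => (expand_single_count_le hΔ x y S T Γ).trans (h.2 y T hT)⟩

theorem notMem_dom_expand_single {Γ Δ : Ctx P} (hΔ : Δ.IsRuntime) {x y : Var} {S : Ty P}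
    (h : Name.var y ∉ Γ.dom) : Name.var y ∉ (Γ.expand (single x S Δ)).dom := by
  rw [mem_dom_var] at h ⊢
  exact fun ⟨T, hT⟩ => h ⟨T, has_of_expand_single hΔ hT⟩

/-- A binding without a vertex is unrestricted, which location bindings never are. -/
theorem IsRuntime.not_has {Γ : Ctx P} (h : Γ.IsRuntime) (h' : IsEmpty Γ.Vert) (b : Binding P) :
    ¬ Γ.Has b := by
  intro hb
  cases b with
  | var x T => exact h x T hb
  | loc l m =>
    rcases has_iff.1 hb with hb' | ⟨v, -⟩
    · have : ∀ Γ : Ctx P, Binding.loc l m ∉ Γ.unrSet := by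
        intro Γ
        induction Γ with
        | empty => exact id
        | bind b => rintro ⟨rfl, h⟩; exact nomatch h
        | seq Γ Γ' h₁ h₂ => exact fun h => h.elim h₁ h₂
        | par Γ Γ' h₁ h₂ => exact fun h => h.elim h₁ h₂
      exact this Γ hb'
    · exact h'.false v

theorem Unr.isEmpty_vert {Γ : Ctx P} (h : Γ.Unr) : IsEmpty Γ.Vert := by
  induction Γ with
  | empty => exact inferInstanceAs (IsEmpty Empty)
  | bind b => exact ⟨fun v => v.down (h b ((bind_has _ _).2 rfl))⟩
  | seq Γ Γ' h₁ h₂ =>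
    have := h₁ fun b hb => h b ((seq_has _ _ _).2 (Or.inl hb))
    have := h₂ fun b hb => h b ((seq_has _ _ _).2 (Or.inr hb))
    exact inferInstanceAs (IsEmpty (Γ.Vert ⊕ Γ'.Vert))
  | par Γ Γ' h₁ h₂ =>
    have := h₁ fun b hb => h b ((par_has _ _ _).2 (Or.inl hb))
    have := h₂ fun b hb => h b ((par_has _ _ _).2 (Or.inr hb))
    exact inferInstanceAs (IsEmpty (Γ.Vert ⊕ Γ'.Vert))

/-- The context of a function followed or preceded by, or parallel to, the one of its argument. -/
def joinFun : Mode → Ctx P → Ctx P → Ctx P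
  | .plain, Γ, Δ => seq Γ Δ
  | .unord, Γ, Δ => par Γ Δ
  | .right, Γ, Δ => seq Γ Δ
  | .left, Γ, Δ => seq Δ Γ

theorem joinFun_has {a : Mode} {Γ Δ : Ctx P} {b : Binding P} :
    (joinFun a Γ Δ).Has b ↔ Γ.Has b ∨ Δ.Has b := by
  cases a <;> simp [joinFun, or_comm]

theorem Sub.joinFun {Γ Γ' Δ Δ' : Ctx P} (h : Γ.Sub Γ') (h' : Δ.Sub Δ') (a : Mode) :
    (joinFun a Γ Δ).Sub (joinFun a Γ' Δ') := by
  cases a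
  exacts [h.seq h', h.par h', h.seq h', h'.seq h]

theorem expand_joinFun (σ : Binding P → Ctx P) (a : Mode) (Γ Δ : Ctx P) :
    (joinFun a Γ Δ).expand σ = joinFun a (Γ.expand σ) (Δ.expand σ) := by
  cases a <;> rfl

end Ctx

/-- Replace every binding `b` of a context pattern by the context `σ b`. -/
def CtxPat.expand {P : Type u} (σ : Binding P → Ctx P) : CtxPat P → CtxPat P
  | hole => hole
  | seqR Γ G => seqR (Γ.expand σ) (expand σ G)
  | seqL G Γ => seqL (expand σ G) (Γ.expand σ)
  | parR Γ G => parR (Γ.expand σ) (expand σ G)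
  | parL G Γ => parL (expand σ G) (Γ.expand σ)

theorem CtxPat.fill_expand {P : Type u} (σ : Binding P → Ctx P) (G : CtxPat P) (Γ : Ctx P) :
    (G.fill Γ).expand σ = (G.expand σ).fill (Γ.expand σ) := by
  induction G <;> simp_all [fill, expand, Ctx.expand]

theorem CtxPat.expand_single_eq_self {P : Type u} {G : CtxPat P}
    (hG : (G.fill Ctx.empty).IsRuntime) (x : Var) (S : Ty P) (Δ : Ctx P) :
    G.expand (Ctx.single x S Δ) = G := by
  induction G with
  | hole => rfl
  | seqR Γ G ih | seqL G Γ ih =>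
    rw [CtxPat.fill, Ctx.isRuntime_seq] at hG
    simp only [CtxPat.expand, ih, hG, Ctx.expand_single_eq_self (Ctx.IsRuntime.var_notMem_dom _ x)]
  | parR Γ G ih | parL G Γ ih =>
    rw [CtxPat.fill, Ctx.isRuntime_par] at hG
    simp only [CtxPat.expand, ih, hG, Ctx.expand_single_eq_self (Ctx.IsRuntime.var_notMem_dom _ x)]

open OrdBorrow.Expr OrdBorrow.Ctx

/-! ### The substitution lemma -/

namespace Typing

variable {P : Type u} [OPM P] {Γ : Ctx P} {M : Expr P} {T : Ty P} {e : Eff}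

theorem lcAt (h : Typing Γ M T e) : M.LcAt 0 := by
  induction h with
  | const => trivial
  | var => trivial
  | loc => trivial
  | abs _ _ _ _ _ _ ih => exact ih.of_openAt
  | uabs _ _ _ _ _ ih => exact ih.of_openAt
  | rabs _ _ _ _ _ ih => exact ih.of_openAt
  | labs _ _ _ _ _ ih => exact ih.of_openAt
  | app _ _ _ ih ih' => exact ⟨ih, ih'⟩
  | uapp _ _ _ ih ih' => exact ⟨ih, ih'⟩
  | rapp _ _ _ ih ih' => exact ⟨ih, ih'⟩
  | lapp _ _ _ ih ih' => exact ⟨ih, ih'⟩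
  | upair _ _ _ ih ih' => exact ⟨ih, ih'⟩
  | opair _ _ _ _ ih ih' => exact ⟨ih, ih'⟩
  | ulet _ _ _ _ _ _ _ _ _ _ ih ih' => exact ⟨ih, ih'.of_open2⟩
  | olet _ _ _ _ _ _ _ _ _ _ ih ih' => exact ⟨ih, ih'.of_open2⟩
  | weaken _ _ _ _ ih => exact ih

theorem exists_has_of_mem_fv (h : Typing Γ M T e) {z : Var} (hz : z ∈ M.fv) :
    ∃ S, Γ.Has (Binding.var z S) := by
  induction h with
  | const => simp [fv] at hz
  | var x T =>
    rw [Finset.mem_singleton.1 hz]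
    exact ⟨T, (bind_has _ _).2 rfl⟩
  | loc => simp [fv] at hz
  | abs x _ _ hM _ _ ih | uabs x _ _ hM _ ih | rabs x _ _ hM _ ih | labs x _ _ hM _ ih =>
    have hne : z ≠ x := fun h => hM (h ▸ hz)
    obtain ⟨S, hS⟩ := ih (fv_subset_fv_openAt _ _ _ hz)
    exact ⟨S, by simpa [hne.symm] using hS⟩
  | app _ _ _ ih ih' | uapp _ _ _ ih ih' | rapp _ _ _ ih ih' | lapp _ _ _ ih ih'
  | upair _ _ _ ih ih' | opair _ _ _ _ ih ih' =>
    rcases Finset.mem_union.1 hz with hz | hz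
    · obtain ⟨S, hS⟩ := ih hz
      exact ⟨S, by simp [hS]⟩
    · obtain ⟨S, hS⟩ := ih' hz
      exact ⟨S, by simp [hS]⟩
  | ulet x y _ _ _ _ hxN hyN _ _ ih ih' | olet x y _ _ _ _ hxN hyN _ _ ih ih' =>
    rcases Finset.mem_union.1 hz with hz | hz
    · obtain ⟨S, hS⟩ := ih hz
      exact ⟨S, (CtxPat.fill_has _ _ _).2 (Or.inr hS)⟩
    · have hx : z ≠ x := fun h => hxN (h ▸ hz)
      have hy : z ≠ y := fun h => hyN (h ▸ hz)
      obtain ⟨S, hS⟩ := ih' (fv_subset_fv_openAt _ _ _ (fv_subset_fv_openAt _ _ _ hz))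
      rw [CtxPat.fill_has] at hS
      exact ⟨S, (CtxPat.fill_has _ _ _).2 (Or.inl (by simpa [hx.symm, hy.symm] using hS))⟩
  | weaken _ _ hs _ ih =>
    obtain ⟨S, hS⟩ := ih hz
    exact ⟨S, hs.has hS⟩

/-- In particular, expressions typed in a run-time context are closed. -/
theorem notMem_fv (h : Typing Γ M T e) {z : Var} (hz : Name.var z ∉ Γ.dom) : z ∉ M.fv :=
  fun h' => hz (mem_dom_var.2 (h.exists_has_of_mem_fv h'))

theorem value_effect (h : Typing Γ M T e) (hM : M.IsValue) : Typing Γ M T false := by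
  induction h with
  | const h => exact .const h
  | var => exact .var _ _
  | loc => exact .loc _ _
  | abs x hΓ hx hM' hU h => exact .abs x hΓ hx hM' hU h
  | uabs x hΓ hx hM' h => exact .uabs x hΓ hx hM' h
  | rabs x hΓ hx hM' h => exact .rabs x hΓ hx hM' h
  | labs x hΓ hx hM' h => exact .labs x hΓ hx hM' h
  | upair hΓ _ _ ih ih' =>
    cases hM with
    | upair h₁ h₂ => exact .upair (e₁ := false) (e₂ := false) hΓ (ih h₁) (ih' h₂)
  | opair hΓ hS _ _ ih ih' =>
    cases hM with
    | opair h₁ h₂ => exact .opair (e₁ := false) (e₂ := false) hΓ (fun _ => rfl) (ih h₁) (ih' h₂)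
  | weaken hΓ _ hs _ ih => exact .weaken hΓ (ih hM) hs le_rfl
  | _ => nomatch hM

/-- Only plain abstractions, constants and pairs of such values have unrestricted type, and the rule
for plain abstractions demands an unrestricted context. The lemma justifies copying and discarding
values, and it shows that an already evaluated left component puts nothing before the hole. -/
theorem isEmpty_vert_of_unr (h : Typing Γ M T e) (hM : M.IsValue) (hT : T.Unr) :
    IsEmpty Γ.Vert := by
  induction h with
  | const h => exact inferInstanceAs (IsEmpty Empty)
  | var => nomatch hM
  | loc => nomatch hT
  | abs x hΓ hx hM' hU h => exact hU.isEmpty_vert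
  | uabs => nomatch hT
  | rabs => nomatch hT
  | labs => nomatch hT
  | upair hΓ _ _ ih ih' =>
    cases hM with
    | upair h₁ h₂ =>
      cases hT with
      | uprod t₁ t₂ =>
        have := ih h₁ t₁
        have := ih' h₂ t₂
        exact inferInstanceAs (IsEmpty (_ ⊕ _))
  | opair hΓ hS _ _ ih ih' =>
    cases hM with
    | opair h₁ h₂ =>
      cases hT with
      | oprod t₁ t₂ =>
        have := ih h₁ t₁
        have := ih' h₂ t₂
        exact inferInstanceAs (IsEmpty (_ ⊕ _))
  | weaken hΓ _ hs _ ih => exact hs.isEmpty_vert (ih hM hT)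
  | _ => nomatch hM

/-- Since `V` is closed, no capture can occur, and since the replacement acts on bindings, every
rule is applied again to the expanded contexts. A bound name chosen by the derivation may coincide
with `x`; then `x` is not in the outer context and the substitution does nothing, so no renaming of
derivations is needed. -/
theorem substitution (h : Typing Γ M T e) {x : Var} {S : Ty P} {Δ : Ctx P} {V : Expr P}
    (hV : Typing Δ V S false) (hΔ : Δ.IsRuntime) (hS : S.Unr → IsEmpty Δ.Vert)
    (hx : ∀ T', Γ.Has (Binding.var x T') → T' = S) :
    Typing (Γ.expand (single x S Δ)) (M.substVar x V) T e := by
  have hVx : ∀ {N : Expr P} {z : Var}, z ∉ N.fv → z ∉ (N.substVar x V).fv := fun {N z} hz h => by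
    rcases Finset.mem_union.1 (fv_subst_subset _ _ _ h) with h | h
    exacts [hz h, hV.notMem_fv (hΔ.var_notMem_dom _) h]
  have hlc := hV.lcAt
  -- The case in which `x` is not bound in the context.
  have htriv : ∀ {Γ : Ctx P} {M : Expr P} {T : Ty P} {e : Eff}, Typing Γ M T e →
      Name.var x ∉ Γ.dom → Typing (Γ.expand (single x S Δ)) (M.substVar x V) T e := by
    intro Γ M T e h hx
    rwa [expand_single_eq_self hx, subst_eq_self (h.notMem_fv hx)]
  induction h with
  | const h => exact .const h
  | var y T =>
    by_cases hy : y = x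
    · subst hy
      obtain rfl := hx T ((bind_has _ _).2 rfl)
      rwa [expand, single_self, Expr.substVar, if_pos rfl]
    · rw [expand, single_of_ne hy, Expr.substVar, if_neg hy]
      exact .var y T
  | loc l m =>
    rw [expand, single, if_neg (by simp)]
    exact .loc l m
  | abs y hΓ hy hM hU h ih =>
    by_cases hyx : y = x
    · subst hyx
      exact htriv (.abs y hΓ hy hM hU h) hy
    · have ih := ih fun T' hT' => hx T' (by simpa [hyx] using hT')
      rw [open1, subst_openAt_fvar_ne hlc hyx, expand, expand, single_of_ne hyx] at ih
      refine .abs y (hΓ.expand_single hΔ _ _) (notMem_dom_expand_single hΔ hy) (hVx hM) ?_ ih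
      intro b hb
      obtain ⟨b', hb', hb⟩ := expand_has.1 hb
      by_cases hb'x : b' = Binding.var x S
      · rw [single, if_pos hb'x] at hb
        -- A binding coming from `Δ` would make `x : S` part of an unrestricted context. Then `S` is
        -- unrestricted and `Δ` has no bindings at all.
        exact absurd hb (hΔ.not_has (hS (show (Binding.var x S).Unr from hb'x ▸ hU _ hb')) b)
      · rw [single, if_neg hb'x, bind_has] at hb
        exact hb ▸ hU _ hb'
  | uabs y hΓ hy hM h ih =>
    by_cases hyx : y = x
    · subst hyx
      exact htriv (.uabs y hΓ hy hM h) hy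
    · have ih := ih fun T' hT' => hx T' (by simpa [hyx] using hT')
      rw [open1, subst_openAt_fvar_ne hlc hyx, expand, expand, single_of_ne hyx] at ih
      exact .uabs y (hΓ.expand_single hΔ _ _) (notMem_dom_expand_single hΔ hy) (hVx hM) ih
  | rabs y hΓ hy hM h ih =>
    by_cases hyx : y = x
    · subst hyx
      exact htriv (.rabs y hΓ hy hM h) hy
    · have ih := ih fun T' hT' => hx T' (by simpa [hyx] using hT')
      rw [open1, subst_openAt_fvar_ne hlc hyx, expand, expand, single_of_ne hyx] at ih
      exact .rabs y (hΓ.expand_single hΔ _ _) (notMem_dom_expand_single hΔ hy) (hVx hM) ih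
  | labs y hΓ hy hM h ih =>
    by_cases hyx : y = x
    · subst hyx
      exact htriv (.labs y hΓ hy hM h) hy
    · have ih := ih fun T' hT' => hx T' (by simpa [hyx] using hT')
      rw [open1, subst_openAt_fvar_ne hlc hyx, expand, expand, single_of_ne hyx] at ih
      exact .labs y (hΓ.expand_single hΔ _ _) (notMem_dom_expand_single hΔ hy) (hVx hM) ih
  | app hΓ _ _ ih ih' =>
    exact .app (hΓ.expand_single hΔ _ _) (ih fun T' hT' => hx T' (by simp [hT']))
      (ih' fun T' hT' => hx T' (by simp [hT']))
  | uapp hΓ _ _ ih ih' =>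
    exact .uapp (hΓ.expand_single hΔ _ _) (ih fun T' hT' => hx T' (by simp [hT']))
      (ih' fun T' hT' => hx T' (by simp [hT']))
  | rapp hΓ _ _ ih ih' =>
    exact .rapp (hΓ.expand_single hΔ _ _) (ih fun T' hT' => hx T' (by simp [hT']))
      (ih' fun T' hT' => hx T' (by simp [hT']))
  | lapp hΓ _ _ ih ih' =>
    exact .lapp (hΓ.expand_single hΔ _ _) (ih fun T' hT' => hx T' (by simp [hT']))
      (ih' fun T' hT' => hx T' (by simp [hT']))
  | upair hΓ _ _ ih ih' =>
    exact .upair (hΓ.expand_single hΔ _ _) (ih fun T' hT' => hx T' (by simp [hT']))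
      (ih' fun T' hT' => hx T' (by simp [hT']))
  | opair hΓ hO _ _ ih ih' =>
    exact .opair (hΓ.expand_single hΔ _ _) hO (ih fun T' hT' => hx T' (by simp [hT']))
      (ih' fun T' hT' => hx T' (by simp [hT']))
  | @ulet G Γ M N S₁ S₂ T e y z hΓ hyz hy hz hyN hzN h₁ h₂ ih ih' =>
    by_cases hyx : y = x
    · subst hyx
      exact htriv (.ulet y z hΓ hyz hy hz hyN hzN h₁ h₂) hy
    by_cases hzx : z = x
    · subst hzx
      exact htriv (.ulet y z hΓ hyz hy hz hyN hzN h₁ h₂) hz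
    have ih := ih fun T' hT' => hx T' ((G.fill_has _ _).2 (Or.inr hT'))
    have ih' := ih' fun T' hT' => hx T' ((G.fill_has _ _).2
      (Or.inl (by rw [G.fill_has] at hT'; simpa [hyx, hzx] using hT')))
    rw [subst_open2_fvar_ne hlc hyx hzx, G.fill_expand, expand, expand, expand, single_of_ne hyx,
      single_of_ne hzx] at ih'
    have hΓ := hΓ.expand_single hΔ x S
    have hy := notMem_dom_expand_single (x := x) (S := S) hΔ hy
    have hz := notMem_dom_expand_single (x := x) (S := S) hΔ hz
    rw [G.fill_expand] at hΓ hy hz ⊢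
    exact .ulet y z hΓ hyz hy hz (hVx hyN) (hVx hzN) ih ih'
  | @olet G Γ M N S₁ S₂ T e y z hΓ hyz hy hz hyN hzN h₁ h₂ ih ih' =>
    by_cases hyx : y = x
    · subst hyx
      exact htriv (.olet y z hΓ hyz hy hz hyN hzN h₁ h₂) hy
    by_cases hzx : z = x
    · subst hzx
      exact htriv (.olet y z hΓ hyz hy hz hyN hzN h₁ h₂) hz
    have ih := ih fun T' hT' => hx T' ((G.fill_has _ _).2 (Or.inr hT'))
    have ih' := ih' fun T' hT' => hx T' ((G.fill_has _ _).2
      (Or.inl (by rw [G.fill_has] at hT'; simpa [hyx, hzx] using hT')))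
    rw [subst_open2_fvar_ne hlc hyx hzx, G.fill_expand, expand, expand, expand, single_of_ne hyx,
      single_of_ne hzx] at ih'
    have hΓ := hΓ.expand_single hΔ x S
    have hy := notMem_dom_expand_single (x := x) (S := S) hΔ hy
    have hz := notMem_dom_expand_single (x := x) (S := S) hΔ hz
    rw [G.fill_expand] at hΓ hy hz ⊢
    exact .olet y z hΓ hyz hy hz (hVx hyN) (hVx hzN) ih ih'
  | weaken hΓ _ hs he ih =>
    -- Weakening may discard or duplicate unrestricted bindings. Replacing them respects `≲` because
    -- `Δ` has no vertices when `S` is unrestricted.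
    refine .weaken (hΓ.expand_single hΔ _ _) (ih fun T' hT' => hx T' (hs.has hT'))
      (hs.expand_sub_expand fun b hb => ?_) he
    by_cases hbx : b = Binding.var x S
    · rw [single, if_pos hbx]
      exact hS (by rwa [hbx] at hb)
    · rw [single, if_neg hbx]
      exact ⟨fun v => v.down hb⟩

end Typing

/-! ### Inversion of typing, and preservation for β-steps -/

namespace Typing

variable {P : Type u} [OPM P] {Γ : Ctx P} {M N : Expr P} {T : Ty P} {e : Eff}

/-- As in the inversion lemmas below, the weakenings at the end of a derivation compose to a single
`≲` and, where effects are recorded, a single inequality of effects. -/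
theorem const_inv {c : Const P} (h : Typing Γ (Expr.const c) T e) :
    Γ.Sub empty ∧ ConstTyping c T := by
  generalize hX : Expr.const c = X at h
  induction h with
  | const h => cases hX; exact ⟨.refl _, h⟩
  | weaken _ _ hs _ ih => exact ⟨hs.trans (ih hX).1, (ih hX).2⟩
  | _ => cases hX

theorem loc_inv {l : Loc} (h : Typing Γ (Expr.loc l) T e) :
    ∃ m, Γ.Sub (bind (Binding.loc l m)) ∧ T = Ty.res m := by
  generalize hX : Expr.loc l = X at h
  induction h with
  | loc l m => cases hX; exact ⟨m, .refl _, rfl⟩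
  | weaken _ _ hs _ ih =>
    obtain ⟨m, h, hT⟩ := ih hX
    exact ⟨m, hs.trans h, hT⟩
  | _ => cases hX

theorem lam_inv {a : Mode} (h : Typing Γ (lam a M) T e) :
    ∃ Γ' S T' e' x, T = Ty.arr a e' S T' ∧ Γ.Sub Γ' ∧ Name.var x ∉ Γ'.dom ∧ x ∉ M.fv ∧
      Typing (joinFun a Γ' (bind (Binding.var x S))) (open1 (fvar x) M) T' e' := by
  generalize hX : lam a M = X at h
  induction h with
  | abs x _ hx hM _ h | uabs x _ hx hM h | rabs x _ hx hM h | labs x _ hx hM h =>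
    cases hX
    exact ⟨_, _, _, _, x, rfl, .refl _, hx, hM, h⟩
  | weaken _ _ hs _ ih =>
    obtain ⟨Γ', S, T', e', x, hT, h, h'⟩ := ih hX
    exact ⟨Γ', S, T', e', x, hT, hs.trans h, h'⟩
  | _ => cases hX

theorem app_inv {a : Mode} (h : Typing Γ (Expr.app a M N) T e) :
    ∃ Γ₁ Γ₂ S e₀ e₁ e₂, Γ.Sub (joinFun a Γ₁ Γ₂) ∧ Typing Γ₁ M (Ty.arr a e₀ S T) e₁ ∧
      Typing Γ₂ N S e₂ ∧ e₀ ⊔ e₁ ⊔ e₂ ≤ e ∧ (a = .right → e₂ = false) ∧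
      (a = .left → e₁ = false) := by
  generalize hX : Expr.app a M N = X at h
  induction h with
  | app _ h₁ h₂ | uapp _ h₁ h₂ =>
    cases hX
    exact ⟨_, _, _, _, _, _, .refl _, h₁, h₂, le_rfl, nofun, nofun⟩
  | rapp _ h₁ h₂ =>
    cases hX
    exact ⟨_, _, _, _, _, _, .refl _, h₁, h₂, by simp, fun _ => rfl, nofun⟩
  | lapp _ h₁ h₂ =>
    cases hX
    exact ⟨_, _, _, _, _, _, .refl _, h₁, h₂, by simp, nofun, fun _ => rfl⟩
  | weaken _ _ hs he ih =>
    obtain ⟨Γ₁, Γ₂, S, e₀, e₁, e₂, h, h₁, h₂, hle, h'⟩ := ih hX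
    exact ⟨Γ₁, Γ₂, S, e₀, e₁, e₂, hs.trans h, h₁, h₂, hle.trans he, h'⟩
  | _ => cases hX

theorem upair_inv (h : Typing Γ (Expr.upair M N) T e) :
    ∃ Γ₁ Γ₂ S₁ S₂ e₁ e₂, T = Ty.uprod S₁ S₂ ∧ Γ.Sub (par Γ₁ Γ₂) ∧ Typing Γ₁ M S₁ e₁ ∧
      Typing Γ₂ N S₂ e₂ ∧ e₁ ⊔ e₂ ≤ e := by
  generalize hX : Expr.upair M N = X at h
  induction h with
  | upair _ h₁ h₂ =>
    cases hX
    exact ⟨_, _, _, _, _, _, rfl, .refl _, h₁, h₂, le_rfl⟩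
  | weaken _ _ hs he ih =>
    obtain ⟨Γ₁, Γ₂, S₁, S₂, e₁, e₂, hT, h, h₁, h₂, hle⟩ := ih hX
    exact ⟨Γ₁, Γ₂, S₁, S₂, e₁, e₂, hT, hs.trans h, h₁, h₂, hle.trans he⟩
  | _ => cases hX

theorem opair_inv (h : Typing Γ (Expr.opair M N) T e) :
    ∃ Γ₁ Γ₂ S₁ S₂ e₁ e₂, T = Ty.oprod S₁ S₂ ∧ Γ.Sub (seq Γ₁ Γ₂) ∧ Typing Γ₁ M S₁ e₁ ∧
      Typing Γ₂ N S₂ e₂ ∧ e₁ ⊔ e₂ ≤ e ∧ (S₁.Ord → e₂ = false) := by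
  generalize hX : Expr.opair M N = X at h
  induction h with
  | opair _ hS h₁ h₂ =>
    cases hX
    exact ⟨_, _, _, _, _, _, rfl, .refl _, h₁, h₂, le_rfl, hS⟩
  | weaken _ _ hs he ih =>
    obtain ⟨Γ₁, Γ₂, S₁, S₂, e₁, e₂, hT, h, h₁, h₂, hle, hS⟩ := ih hX
    exact ⟨Γ₁, Γ₂, S₁, S₂, e₁, e₂, hT, hs.trans h, h₁, h₂, hle.trans he, hS⟩
  | _ => cases hX

theorem ulet_inv (h : Typing Γ (Expr.ulet M N) T e) :
    ∃ (G : CtxPat P) (Δ : Ctx P) (S₁ S₂ : Ty P) (x y : Var) (e' : Eff), Γ.Sub (G.fill Δ) ∧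
      x ≠ y ∧ x ∉ N.fv ∧ y ∉ N.fv ∧ Typing Δ M (Ty.uprod S₁ S₂) false ∧
      Typing (G.fill (par (bind (Binding.var x S₁)) (bind (Binding.var y S₂))))
        (open2 (fvar x) (fvar y) N) T e' ∧ e' ≤ e := by
  generalize hX : Expr.ulet M N = X at h
  induction h with
  | ulet x y _ hxy _ _ hxN hyN h₁ h₂ =>
    cases hX
    exact ⟨_, _, _, _, x, y, _, .refl _, hxy, hxN, hyN, h₁, h₂, le_rfl⟩
  | weaken _ _ hs he ih =>
    obtain ⟨G, Δ, S₁, S₂, x, y, e', h, hxy, hxN, hyN, h₁, h₂, hle⟩ := ih hX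
    exact ⟨G, Δ, S₁, S₂, x, y, e', hs.trans h, hxy, hxN, hyN, h₁, h₂, hle.trans he⟩
  | _ => cases hX

theorem olet_inv (h : Typing Γ (Expr.olet M N) T e) :
    ∃ (G : CtxPat P) (Δ : Ctx P) (S₁ S₂ : Ty P) (x y : Var) (e' : Eff), Γ.Sub (G.fill Δ) ∧
      x ≠ y ∧ x ∉ N.fv ∧ y ∉ N.fv ∧ Typing Δ M (Ty.oprod S₁ S₂) false ∧
      Typing (G.fill (seq (bind (Binding.var x S₁)) (bind (Binding.var y S₂))))
        (open2 (fvar x) (fvar y) N) T e' ∧ e' ≤ e := by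
  generalize hX : Expr.olet M N = X at h
  induction h with
  | olet x y _ hxy _ _ hxN hyN h₁ h₂ =>
    cases hX
    exact ⟨_, _, _, _, x, y, _, .refl _, hxy, hxN, hyN, h₁, h₂, le_rfl⟩
  | weaken _ _ hs he ih =>
    obtain ⟨G, Δ, S₁, S₂, x, y, e', h, hxy, hxN, hyN, h₁, h₂, hle⟩ := ih hX
    exact ⟨G, Δ, S₁, S₂, x, y, e', hs.trans h, hxy, hxN, hyN, h₁, h₂, hle.trans he⟩
  | _ => cases hX

theorem le_effect {e' : Eff} (h : Typing Γ M T e) (hΓ : Γ.IsRuntime) (he : e ≤ e') :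
    Typing Γ M T e' :=
  .weaken hΓ.wf h (.refl _) he

/-- The converse of `app_inv`, uniform in the four kinds, used to rebuild applications around a
reduced subexpression. -/
theorem app_intro {a : Mode} {Γ₁ Γ₂ : Ctx P} {S : Ty P} {e₀ e₁ e₂ : Eff}
    (hΓ : (joinFun a Γ₁ Γ₂).IsRuntime) (h₁ : Typing Γ₁ M (Ty.arr a e₀ S T) e₁)
    (h₂ : Typing Γ₂ N S e₂) (he : e₀ ⊔ e₁ ⊔ e₂ ≤ e) (hr : a = .right → e₂ = false)
    (hl : a = .left → e₁ = false) : Typing (joinFun a Γ₁ Γ₂) (Expr.app a M N) T e := by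
  refine le_effect (e := e₀ ⊔ e₁ ⊔ e₂) ?_ hΓ he
  cases a with
  | plain => exact .app hΓ.wf h₁ h₂
  | unord => exact .uapp hΓ.wf h₁ h₂
  | right =>
    cases hr rfl
    change Typing (seq Γ₁ Γ₂) _ _ _
    simpa using Typing.rapp hΓ.wf h₁ h₂
  | left =>
    cases hl rfl
    change Typing (seq Γ₂ Γ₁) _ _ _
    simpa using Typing.lapp hΓ.wf h₁ h₂

theorem substitution_value {x : Var} {S : Ty P} {Δ : Ctx P} {V : Expr P} {e' : Eff}
    (h : Typing Γ M T e) (hV : Typing Δ V S e') (hval : V.IsValue) (hΔ : Δ.IsRuntime)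
    (hx : ∀ T', Γ.Has (Binding.var x T') → T' = S) :
    Typing (Γ.expand (single x S Δ)) (M.substVar x V) T e :=
  h.substitution (hV.value_effect hval) hΔ (hV.isEmpty_vert_of_unr hval) hx

/-- `D` stands for either composition of the two variable bindings. The surrounding pattern contains
no variables, so only `D` is changed. -/
theorem substitution_pair {G : CtxPat P} {D Γ₁ Γ₂ : Ctx P} {x y : Var} {S₁ S₂ : Ty P}
    {V₁ V₂ : Expr P} {e₁ e₂ : Eff} (hG : (G.fill empty).IsRuntime)
    (h : Typing (G.fill D) (open2 (fvar x) (fvar y) N) T e)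
    (hD : ∀ b, D.Has b → b = Binding.var x S₁ ∨ b = Binding.var y S₂)
    (hxy : x ≠ y) (hx : x ∉ N.fv) (hy : y ∉ N.fv)
    (h₁ : Typing Γ₁ V₁ S₁ e₁) (hV₁ : V₁.IsValue) (hΓ₁ : Γ₁.IsRuntime)
    (h₂ : Typing Γ₂ V₂ S₂ e₂) (hV₂ : V₂.IsValue) (hΓ₂ : Γ₂.IsRuntime) :
    Typing (G.fill ((D.expand (single x S₁ Γ₁)).expand (single y S₂ Γ₂))) (open2 V₁ V₂ N) T e := by
  have hGD : ∀ z U, (G.fill D).Has (Binding.var z U) → D.Has (Binding.var z U) := fun z U hU =>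
    ((G.fill_has _ _).1 hU).resolve_left (hG z U)
  have h := h.substitution_value h₁ hV₁ hΓ₁ fun T' hT' => by
    simpa [hxy] using hD _ (hGD x _ hT')
  have h := h.substitution_value h₂ hV₂ hΓ₂ fun T' hT' => by
    simpa [hxy.symm] using hD _ (hGD y _ (has_of_expand_single hΓ₁ hT'))
  rwa [subst_subst_open2 h₁.lcAt h₂.lcAt hxy hx hy (h₁.notMem_fv (hΓ₁.var_notMem_dom y)),
    G.fill_expand, CtxPat.expand_single_eq_self hG, G.fill_expand,
    CtxPat.expand_single_eq_self hG] at h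

theorem beta (h : Typing Γ M T e) (hΓ : Γ.IsRuntime) (hs : BetaStep M N) : Typing Γ N T e := by
  cases hs with
  | beta a M V hV =>
    obtain ⟨Γ₁, Γ₂, S, e₀, e₁, e₂, hsub, h₁, h₂, he, -⟩ := h.app_inv
    obtain ⟨Γ', S', T', e', x, hT, hsub', hx, hM, h⟩ := h₁.lam_inv
    cases hT
    have hrt := hsub.isRuntime hΓ
    have hΓ₂ : Γ₂.IsRuntime := fun y U hU => hrt y U (joinFun_has.2 (Or.inr hU))
    have := h.substitution_value h₂ hV hΓ₂ fun T' hT' => by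
      rcases joinFun_has.1 hT' with hT' | hT'
      · exact absurd (mem_dom_var.2 ⟨_, hT'⟩) hx
      · simpa using ((bind_has _ _).1 hT').symm
    rw [expand_joinFun, expand_single_eq_self hx, expand, single_self, open1,
      subst_openAt_fvar_self h₂.lcAt hM] at this
    -- The expanded body context is `joinFun a Γ' Γ₂`, the join of the function and argument
    -- contexts with the function's weakening stripped; the latent effect is bounded by `e`.
    exact .weaken hΓ.wf this (hsub.trans (hsub'.joinFun (.refl _) a))
      ((le_sup_left.trans le_sup_left).trans he)
  | ulet V₁ V₂ N hV₁ hV₂ =>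
    obtain ⟨G, Δ, S₁, S₂, x, y, e', hsub, hxy, hx, hy, h₁, h₂, he⟩ := h.ulet_inv
    obtain ⟨Γ₁, Γ₂, S₁', S₂', e₁, e₂, hT, hsub', h₁₁, h₁₂, -⟩ := h₁.upair_inv
    cases hT
    have hsub := hsub.trans (hsub'.fill G)
    have hG := CtxPat.isRuntime_fill.1 (hsub.isRuntime hΓ)
    obtain ⟨hΓ₁, hΓ₂⟩ := isRuntime_par.1 hG.2
    have := substitution_pair hG.1 h₂ (fun b hb => by simpa [eq_comm] using hb) hxy hx hy
      h₁₁ hV₁ hΓ₁ h₁₂ hV₂ hΓ₂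
    simp only [expand, single_self, single_of_ne hxy.symm,
      Ctx.expand_single_eq_self (hΓ₁.var_notMem_dom y)] at this
    exact .weaken hΓ.wf this hsub he
  | olet V₁ V₂ N hV₁ hV₂ =>
    obtain ⟨G, Δ, S₁, S₂, x, y, e', hsub, hxy, hx, hy, h₁, h₂, he⟩ := h.olet_inv
    obtain ⟨Γ₁, Γ₂, S₁', S₂', e₁, e₂, hT, hsub', h₁₁, h₁₂, -⟩ := h₁.opair_inv
    cases hT
    have hsub := hsub.trans (hsub'.fill G)
    have hG := CtxPat.isRuntime_fill.1 (hsub.isRuntime hΓ)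
    obtain ⟨hΓ₁, hΓ₂⟩ := isRuntime_seq.1 hG.2
    have := substitution_pair hG.1 h₂ (fun b hb => by simpa [eq_comm] using hb) hxy hx hy
      h₁₁ hV₁ hΓ₁ h₁₂ hV₂ hΓ₂
    simp only [expand, single_self, single_of_ne hxy.symm,
      Ctx.expand_single_eq_self (hΓ₁.var_notMem_dom y)] at this
    exact .weaken hΓ.wf this hsub he

end Typing

/-! ### Decomposing a typing along an evaluation context -/

/-- The composition of context patterns. -/
def CtxPat.comp {P : Type u} : CtxPat P → CtxPat P → CtxPat P
  | hole, G' => G'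
  | seqR Γ G, G' => seqR Γ (comp G G')
  | seqL G Γ, G' => seqL (comp G G') Γ
  | parR Γ G, G' => parR Γ (comp G G')
  | parL G Γ, G' => parL (comp G G') Γ

theorem CtxPat.fill_comp {P : Type u} (G G' : CtxPat P) (Δ : Ctx P) :
    (G.comp G').fill Δ = G.fill (G'.fill Δ) := by
  induction G <;> simp_all [comp, fill]

theorem CtxPat.isRuntime_fill_of_fill {P : Type u} {G : CtxPat P} {Δ Δ' : Ctx P}
    (h : (G.fill Δ).IsRuntime) (h' : Δ'.IsRuntime) : (G.fill Δ').IsRuntime :=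
  isRuntime_fill.2 ⟨(isRuntime_fill.1 h).1, h'⟩

variable {P : Type u} [OPM P]

/-- The pattern `G`, the context `Δ`, the type `S` and the effect `e'` belong to the hole of an
evaluation context `E` with `Γ ⊢ E[M] : T | e`. -/
structure HoleTyping (E : ECtx P) (M : Expr P) (T : Ty P) (e : Eff) (G : CtxPat P) (Δ : Ctx P)
    (S : Ty P) (e' : Eff) : Prop where
  typing : Typing Δ M S e'
  replace : ∀ M' Δ', Δ'.IsRuntime → Typing Δ' M' S e' → Typing (G.fill Δ') (E.fill M') T e
  lead : e' = true → e = true ∧ G.Lead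

/-- The shape of `G` follows `E`. The `lead` part is where evaluation order and effect restrictions
meet: if a context lies to the left of the hole, either its expression is a value of unrestricted
type or the typing rule forces effect 0 in the hole. -/
theorem Typing.exists_holeTyping (E : ECtx P) {Γ : Ctx P} {M : Expr P} {T : Ty P} {e : Eff}
    (h : Typing Γ (E.fill M) T e) (hΓ : Γ.IsRuntime) :
    ∃ G Δ S e', Γ.Sub (G.fill Δ) ∧ HoleTyping E M T e G Δ S e' := by
  induction E generalizing Γ T e with
  | hole => exact ⟨.hole, Γ, T, e, .refl _, h, fun M' Δ' _ h' => h', fun h => ⟨h, trivial⟩⟩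
  | appL a ha E N ih =>
    obtain ⟨Γ₁, Γ₂, S, e₀, e₁, e₂, hsub, h₁, h₂, he, hr, hl⟩ := app_inv h
    have hrt := hsub.isRuntime hΓ
    obtain ⟨G, Δ, S', e', hsub', hty, hrep, hlead⟩ :=
      ih h₁ fun y U hU => hrt y U (joinFun_has.2 (Or.inl hU))
    have hsub := hsub.trans (hsub'.joinFun (.refl Γ₂) a)
    have hrt := hsub.isRuntime hΓ
    have he₁ : e₁ ≤ e := (le_sup_right.trans le_sup_left).trans he
    have hlead' : e' = true → e = true := fun h' => by
      have := (hlead h').1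
      subst this
      exact top_unique he₁
    cases a with
    | plain =>
      exact ⟨.seqL G Γ₂, Δ, S', e', hsub, hty, fun M' Δ' hΔ' h' => app_intro (a := .plain)
        (CtxPat.isRuntime_fill_of_fill (G := .seqL G Γ₂) hrt hΔ') (hrep _ _ hΔ' h') h₂ he hr hl,
        fun h' => ⟨hlead' h', (hlead h').2⟩⟩
    | unord =>
      exact ⟨.parL G Γ₂, Δ, S', e', hsub, hty, fun M' Δ' hΔ' h' => app_intro (a := .unord)
        (CtxPat.isRuntime_fill_of_fill (G := .parL G Γ₂) hrt hΔ') (hrep _ _ hΔ' h') h₂ he hr hl,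
        fun h' => ⟨hlead' h', (hlead h').2⟩⟩
    | right =>
      exact ⟨.seqL G Γ₂, Δ, S', e', hsub, hty, fun M' Δ' hΔ' h' => app_intro (a := .right)
        (CtxPat.isRuntime_fill_of_fill (G := .seqL G Γ₂) hrt hΔ') (hrep _ _ hΔ' h') h₂ he hr hl,
        fun h' => ⟨hlead' h', (hlead h').2⟩⟩
    | left => exact absurd rfl ha
  | appR a ha V hV E ih =>
    obtain ⟨Γ₁, Γ₂, S, e₀, e₁, e₂, hsub, h₁, h₂, he, hr, hl⟩ := app_inv h
    have hrt := hsub.isRuntime hΓ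
    obtain ⟨G, Δ, S', e', hsub', hty, hrep, hlead⟩ :=
      ih h₂ fun y U hU => hrt y U (joinFun_has.2 (Or.inr hU))
    have hsub := hsub.trans (Sub.joinFun (.refl Γ₁) hsub' a)
    have hrt := hsub.isRuntime hΓ
    have he₂ : e₂ ≤ e := le_sup_right.trans he
    have hlead' : e' = true → e = true := fun h' => by
      have := (hlead h').1
      subst this
      exact top_unique he₂
    cases a with
    | plain =>
      -- The function is already a value, and its plain arrow type is unrestricted, so `Γ₁` has no
      -- vertices.
      exact ⟨.seqR Γ₁ G, Δ, S', e', hsub, hty, fun M' Δ' hΔ' h' => app_intro (a := .plain)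
        (CtxPat.isRuntime_fill_of_fill (G := .seqR Γ₁ G) hrt hΔ') h₁ (hrep _ _ hΔ' h') he hr hl,
        fun h' => ⟨hlead' h',
          verts_eq_nil_iff.2 (h₁.isEmpty_vert_of_unr hV (.arr _ _ _)), (hlead h').2⟩⟩
    | unord =>
      exact ⟨.parR Γ₁ G, Δ, S', e', hsub, hty, fun M' Δ' hΔ' h' => app_intro (a := .unord)
        (CtxPat.isRuntime_fill_of_fill (G := .parR Γ₁ G) hrt hΔ') h₁ (hrep _ _ hΔ' h') he hr hl,
        fun h' => ⟨hlead' h', (hlead h').2⟩⟩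
    | right =>
      refine ⟨.seqR Γ₁ G, Δ, S', e', hsub, hty, fun M' Δ' hΔ' h' => app_intro (a := .right)
        (CtxPat.isRuntime_fill_of_fill (G := .seqR Γ₁ G) hrt hΔ') h₁ (hrep _ _ hΔ' h') he hr hl,
        fun h' => ?_⟩
      -- In a right application the argument has effect 0, so the hole cannot have effect 1.
      cases (hlead h').1.symm.trans (hr rfl)
    | left => exact absurd rfl ha
  | lappL E V hV ih =>
    obtain ⟨Γ₁, Γ₂, S, e₀, e₁, e₂, hsub, h₁, h₂, he, hr, hl⟩ := app_inv h
    have hrt := hsub.isRuntime hΓ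
    obtain ⟨G, Δ, S', e', hsub', hty, hrep, hlead⟩ :=
      ih h₁ fun y U hU => hrt y U (joinFun_has.2 (Or.inl hU))
    have hsub := hsub.trans (hsub'.joinFun (.refl Γ₂) .left)
    have hrt := hsub.isRuntime hΓ
    refine ⟨.seqR Γ₂ G, Δ, S', e', hsub, hty, fun M' Δ' hΔ' h' => app_intro (a := .left)
      (CtxPat.isRuntime_fill_of_fill (G := .seqR Γ₂ G) hrt hΔ') (hrep _ _ hΔ' h') h₂ he hr hl,
      fun h' => ?_⟩
    cases (hlead h').1.symm.trans (hl rfl)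
  | lappR N E ih =>
    obtain ⟨Γ₁, Γ₂, S, e₀, e₁, e₂, hsub, h₁, h₂, he, hr, hl⟩ := app_inv h
    have hrt := hsub.isRuntime hΓ
    obtain ⟨G, Δ, S', e', hsub', hty, hrep, hlead⟩ :=
      ih h₂ fun y U hU => hrt y U (joinFun_has.2 (Or.inr hU))
    have hsub := hsub.trans (Sub.joinFun (.refl Γ₁) hsub' .left)
    have hrt := hsub.isRuntime hΓ
    have he₂ : e₂ ≤ e := le_sup_right.trans he
    -- In a left application the argument's context comes first, so the function's context lies
    -- after the hole.
    refine ⟨.seqL G Γ₁, Δ, S', e', hsub, hty, fun M' Δ' hΔ' h' => app_intro (a := .left)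
      (CtxPat.isRuntime_fill_of_fill (G := .seqL G Γ₁) hrt hΔ') h₁ (hrep _ _ hΔ' h') he hr hl,
      fun h' => ⟨?_, (hlead h').2⟩⟩
    rw [(hlead h').1] at he₂
    exact top_unique he₂
  | upairL E N ih =>
    obtain ⟨Γ₁, Γ₂, S₁, S₂, e₁, e₂, rfl, hsub, h₁, h₂, he⟩ := upair_inv h
    obtain ⟨G, Δ, S', e', hsub', hty, hrep, hlead⟩ :=
      ih h₁ (isRuntime_par.1 (hsub.isRuntime hΓ)).1
    have hsub := hsub.trans (hsub'.par (.refl Γ₂))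
    have hrt {Δ' : Ctx P} := CtxPat.isRuntime_fill_of_fill (G := .parL G Γ₂) (Δ' := Δ')
      (hsub.isRuntime hΓ)
    refine ⟨.parL G Γ₂, Δ, S', e', hsub, hty, fun M' Δ' hΔ' h' =>
      le_effect (.upair (hrt hΔ').wf (hrep _ _ hΔ' h') h₂) (hrt hΔ') he,
      fun h' => ⟨?_, (hlead h').2⟩⟩
    rw [(hlead h').1] at he
    exact top_unique (le_sup_left.trans he)
  | upairR V hV E ih =>
    obtain ⟨Γ₁, Γ₂, S₁, S₂, e₁, e₂, rfl, hsub, h₁, h₂, he⟩ := upair_inv h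
    obtain ⟨G, Δ, S', e', hsub', hty, hrep, hlead⟩ :=
      ih h₂ (isRuntime_par.1 (hsub.isRuntime hΓ)).2
    have hsub := hsub.trans (Sub.par (.refl Γ₁) hsub')
    have hrt {Δ' : Ctx P} := CtxPat.isRuntime_fill_of_fill (G := .parR Γ₁ G) (Δ' := Δ')
      (hsub.isRuntime hΓ)
    refine ⟨.parR Γ₁ G, Δ, S', e', hsub, hty, fun M' Δ' hΔ' h' =>
      le_effect (.upair (hrt hΔ').wf h₁ (hrep _ _ hΔ' h')) (hrt hΔ') he,
      fun h' => ⟨?_, (hlead h').2⟩⟩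
    rw [(hlead h').1] at he
    exact top_unique (le_sup_right.trans he)
  | opairL E N ih =>
    obtain ⟨Γ₁, Γ₂, S₁, S₂, e₁, e₂, rfl, hsub, h₁, h₂, he, hS⟩ := opair_inv h
    obtain ⟨G, Δ, S', e', hsub', hty, hrep, hlead⟩ :=
      ih h₁ (isRuntime_seq.1 (hsub.isRuntime hΓ)).1
    have hsub := hsub.trans (hsub'.seq (.refl Γ₂))
    have hrt {Δ' : Ctx P} := CtxPat.isRuntime_fill_of_fill (G := .seqL G Γ₂) (Δ' := Δ')
      (hsub.isRuntime hΓ)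
    refine ⟨.seqL G Γ₂, Δ, S', e', hsub, hty, fun M' Δ' hΔ' h' =>
      le_effect (.opair (hrt hΔ').wf hS (hrep _ _ hΔ' h') h₂) (hrt hΔ') he,
      fun h' => ⟨?_, (hlead h').2⟩⟩
    rw [(hlead h').1] at he
    exact top_unique (le_sup_left.trans he)
  | opairR V hV E ih =>
    obtain ⟨Γ₁, Γ₂, S₁, S₂, e₁, e₂, rfl, hsub, h₁, h₂, he, hS⟩ := opair_inv h
    obtain ⟨G, Δ, S', e', hsub', hty, hrep, hlead⟩ :=
      ih h₂ (isRuntime_seq.1 (hsub.isRuntime hΓ)).2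
    have hsub := hsub.trans (Sub.seq (.refl Γ₁) hsub')
    have hrt {Δ' : Ctx P} := CtxPat.isRuntime_fill_of_fill (G := .seqR Γ₁ G) (Δ' := Δ')
      (hsub.isRuntime hΓ)
    refine ⟨.seqR Γ₁ G, Δ, S', e', hsub, hty, fun M' Δ' hΔ' h' =>
      le_effect (.opair (hrt hΔ').wf hS h₁ (hrep _ _ hΔ' h')) (hrt hΔ') he,
      fun h' => ⟨?_, ?_, (hlead h').2⟩⟩
    · rw [(hlead h').1] at he
      exact top_unique (le_sup_right.trans he)
    -- An effect in the second component forces the first type to be unrestricted, and the first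
    -- component is a value.
    · have hne : e₂ ≠ false := by simp [(hlead h').1]
      have hS₁ : S₁.Unr := by
        by_contra hS₁
        exact hne (hS (S₁.ord_iff_not_unr.2 hS₁))
      exact verts_eq_nil_iff.2 (h₁.isEmpty_vert_of_unr hV hS₁)
  | ulet E N ih =>
    obtain ⟨G₀, Γ₀, S₁, S₂, x, y, e₀, hsub, hxy, hx, hy, h₁, h₂, he⟩ := ulet_inv h
    obtain ⟨G, Δ, S', e', hsub', hty, hrep, hlead⟩ :=
      ih h₁ (CtxPat.isRuntime_fill.1 (hsub.isRuntime hΓ)).2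
    have hsub := hsub.trans (hsub'.fill G₀)
    rw [← CtxPat.fill_comp] at hsub
    have hrt {Δ' : Ctx P} := CtxPat.isRuntime_fill_of_fill (G := G₀.comp G) (Δ' := Δ')
      (hsub.isRuntime hΓ)
    refine ⟨G₀.comp G, Δ, S', e', hsub, hty, fun M' Δ' hΔ' h' => ?_, fun h' => ?_⟩
    · have hrt := hrt hΔ'
      rw [CtxPat.fill_comp] at hrt ⊢
      exact le_effect (.ulet x y hrt.wf hxy (hrt.var_notMem_dom x) (hrt.var_notMem_dom y) hx hy
        (hrep _ _ hΔ' h') h₂) hrt he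
    -- The expression that is destructed has effect 0.
    · cases (hlead h').1
  | olet E N ih =>
    obtain ⟨G₀, Γ₀, S₁, S₂, x, y, e₀, hsub, hxy, hx, hy, h₁, h₂, he⟩ := olet_inv h
    obtain ⟨G, Δ, S', e', hsub', hty, hrep, hlead⟩ :=
      ih h₁ (CtxPat.isRuntime_fill.1 (hsub.isRuntime hΓ)).2
    have hsub := hsub.trans (hsub'.fill G₀)
    rw [← CtxPat.fill_comp] at hsub
    have hrt {Δ' : Ctx P} := CtxPat.isRuntime_fill_of_fill (G := G₀.comp G) (Δ' := Δ')
      (hsub.isRuntime hΓ)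
    refine ⟨G₀.comp G, Δ, S', e', hsub, hty, fun M' Δ' hΔ' h' => ?_, fun h' => ?_⟩
    · have hrt := hrt hΔ'
      rw [CtxPat.fill_comp] at hrt ⊢
      exact le_effect (.olet x y hrt.wf hxy (hrt.var_notMem_dom x) (hrt.var_notMem_dom y) hx hy
        (hrep _ _ hΔ' h') h₂) hrt he
    · cases (hlead h').1

/-! ### Preservation for heap steps -/

/-- The context of the constant has no vertices, so it can be removed by passing to a larger context
for `≲`. -/
theorem Typing.const_app_inv {Γ : Ctx P} {c : Const P} {N : Expr P} {T : Ty P} {e : Eff}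
    (h : Typing Γ (Expr.app Mode.plain (Expr.const c) N) T e) :
    ∃ Δ S e₀ e₁, Γ.Sub Δ ∧ ConstTyping c (Ty.arr Mode.plain e₀ S T) ∧ Typing Δ N S e₁ ∧
      e₀ ≤ e := by
  obtain ⟨Γ₁, Γ₂, S, e₀, e₁, e₂, hsub, h₁, h₂, he, -⟩ := h.app_inv
  obtain ⟨hs, hc⟩ := h₁.const_inv
  have he₁ := hs.isEmpty_vert (inferInstanceAs (IsEmpty Empty))
  exact ⟨Γ₂, S, e₀, e₂, hsub.trans (seq_sub_right he₁), hc, h₂, (le_sup_left.trans le_sup_left).trans he⟩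

theorem Typing.const_app_loc_inv {Γ : Ctx P} {c : Const P} {l : Loc} {T : Ty P} {e : Eff}
    (h : Typing Γ (Expr.app Mode.plain (Expr.const c) (Expr.loc l)) T e) :
    ∃ m e₀, Γ.Sub (bind (Binding.loc l m)) ∧
      ConstTyping c (Ty.arr Mode.plain e₀ (Ty.res m) T) ∧ e₀ ≤ e := by
  obtain ⟨Δ, S, e₀, e₁, hsub, hc, hN, he⟩ := h.const_app_inv
  obtain ⟨m, hsub', rfl⟩ := hN.loc_inv
  exact ⟨m, e₀, hsub.trans hsub', hc, he⟩

/-- Heap typing is preserved when the part `Δ` of the context is replaced by `Δ'` and the heap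
changes accordingly at the location `l`, which is the only one in `Δ` and `Δ'`. -/
theorem Ctx.TypesHeap.replace {G : CtxPat P} {Δ Δ' : Ctx P} {H H' : Heap P} {l : Loc}
    (h : (G.fill Δ).TypesHeap H) (hrt : (G.fill Δ).IsRuntime) (hΔ' : Δ'.IsRuntime)
    (hl : ((G.focus l).fill (Δ.focus l)).Fits (H.lookup l) →
      ((G.focus l).fill (Δ'.focus l)).Fits (H'.lookup l))
    (hne : ∀ l', l' ≠ l → H'.lookup l' = H.lookup l' ∧ (Δ.focus l').verts = [] ∧
      (Δ'.focus l').verts = []) :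
    (G.fill Δ').TypesHeap H' := by
  rw [typesHeap_iff hrt] at h
  rw [typesHeap_iff (CtxPat.isRuntime_fill_of_fill hrt hΔ')]
  intro l'
  have h := h l'
  rw [CtxPat.fill_focus] at h ⊢
  by_cases hl' : l' = l
  · subst hl'
    exact hl h
  · obtain ⟨hH, hv, hv'⟩ := hne l' hl'
    rw [hH]
    exact h.fill_of_verts_eq_nil hv hv'

/-- After inversion the redex context is a single binding of `l`, or has no vertices when a location
is created. The new context binds only `l`, so all other locations keep their entries and their
focused bindings. -/
theorem CfgStep.preservation {M M' : Expr P} {H H' : Heap P} (hs : CfgStep M H M' H')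
    {G : CtxPat P} {Δ : Ctx P} {S : Ty P} {e : Eff} (hM : Typing Δ M S e)
    (hrt : (G.fill Δ).IsRuntime) (hG : e = true → G.Lead) (hH : (G.fill Δ).TypesHeap H) :
    ∃ Δ' : Ctx P, Δ'.IsRuntime ∧ Typing Δ' M' S e ∧ (G.fill Δ').TypesHeap H' := by
  cases hs with
  | new m l H hl =>
    obtain ⟨Δ₁, S₁, e₀, e₁, hsub, hc, hN, he⟩ := hM.const_app_inv
    obtain ⟨hsub', -⟩ := hN.const_inv
    have hv : Δ.verts = [] := verts_eq_nil_iff.2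
      ((hsub.trans hsub').isEmpty_vert (inferInstanceAs (IsEmpty Empty)))
    cases hc
    refine ⟨bind (Binding.loc l m), isRuntime_bind_loc l m,
      (Typing.loc l m).le_effect (isRuntime_bind_loc l m) (Bool.false_le _),
      hH.replace hrt (isRuntime_bind_loc l m) (l := l) (fun h => ?_) fun l' hl' => ?_⟩
    · rw [Finmap.lookup_eq_none.2 hl] at h
      rw [Finmap.lookup_insert, focus_bind_loc_self]
      exact h.new
    · rw [focus_bind_loc_of_ne hl', Finmap.lookup_insert_of_ne _ hl']
      exact ⟨rfl, focus_verts_eq_nil hv l', rfl⟩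
  | op m l H n m₀ m' p hp hm =>
    obtain ⟨k, e₀, hsub, hc, he⟩ := hM.const_app_loc_inv
    have hH := hH.mono hrt (hsub.fill G)
    have hrt := (hsub.fill G).isRuntime hrt
    cases hc with
    | op _ _ m₂ hk =>
      refine ⟨bind (Binding.loc l m₂), isRuntime_bind_loc l m₂,
        (Typing.loc l m₂).le_effect (isRuntime_bind_loc l m₂) (Bool.false_le _),
        hH.replace hrt (isRuntime_bind_loc l m₂) (l := l) (fun h => ?_) fun l' hl' => ?_⟩
      · rw [Finmap.lookup_insert, focus_bind_loc_self] at h ⊢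
        -- The latent effect of an operation is 1, so the redex has effect 1 and the hole leads.
        exact h.op ((hG (top_unique he)).focus l) hk hp
      · rw [focus_bind_loc_of_ne hl', focus_bind_loc_of_ne hl', Finmap.lookup_insert_of_ne _ hl',
          Finmap.lookup_insert_of_ne _ hl']
        exact ⟨rfl, rfl, rfl⟩
  | drop₁ l H n m₀ m =>
    obtain ⟨k, e₀, hsub, hc, he⟩ := hM.const_app_loc_inv
    have hH := hH.mono hrt (hsub.fill G)
    have hrt := (hsub.fill G).isRuntime hrt
    cases hc with
    | drop _ hk =>
      refine ⟨empty, isRuntime_empty,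
        (Typing.const .unit).le_effect isRuntime_empty (Bool.false_le _),
        hH.replace hrt isRuntime_empty (l := l) (fun h => ?_) fun l' hl' => ?_⟩
      · rw [Finmap.lookup_insert, focus_bind_loc_self] at h
        rw [Finmap.lookup_insert]
        exact h.drop_succ hk
      · rw [focus_bind_loc_of_ne hl', Finmap.lookup_insert_of_ne _ hl',
          Finmap.lookup_insert_of_ne _ hl']
        exact ⟨rfl, rfl, rfl⟩
  | drop₂ l H m₀ m hl hm =>
    obtain ⟨k, e₀, hsub, hc, he⟩ := hM.const_app_loc_inv
    have hH := hH.mono hrt (hsub.fill G)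
    have hrt := (hsub.fill G).isRuntime hrt
    cases hc with
    | drop _ hk =>
      refine ⟨empty, isRuntime_empty,
        (Typing.const .unit).le_effect isRuntime_empty (Bool.false_le _),
        hH.replace hrt isRuntime_empty (l := l) (fun h => ?_) fun l' hl' => ?_⟩
      · rw [Finmap.lookup_insert, focus_bind_loc_self] at h
        rw [Finmap.lookup_eq_none.2 hl]
        exact h.drop_zero
      · rw [focus_bind_loc_of_ne hl', Finmap.lookup_insert_of_ne _ hl']
        exact ⟨rfl, rfl, rfl⟩
  | split m₁ m₂ l H n m₀ m =>
    obtain ⟨k, e₀, hsub, hc, he⟩ := hM.const_app_loc_inv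
    have hH := hH.mono hrt (hsub.fill G)
    have hrt := (hsub.fill G).isRuntime hrt
    cases hc with
    | split _ _ _ hk =>
      have hrt' : (seq (bind (Binding.loc l m₁)) (bind (Binding.loc l m₂))).IsRuntime :=
        isRuntime_seq.2 ⟨isRuntime_bind_loc l m₁, isRuntime_bind_loc l m₂⟩
      refine ⟨_, hrt', (Typing.opair hrt'.wf (fun _ => rfl) (.loc l m₁) (.loc l m₂)).le_effect hrt'
        (Bool.false_le _), hH.replace hrt hrt' (l := l) (fun h => ?_) fun l' hl' => ?_⟩
      · rw [Finmap.lookup_insert, focus_bind_loc_self] at h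
        rw [Finmap.lookup_insert, focus, focus_bind_loc_self, focus_bind_loc_self]
        exact h.split hk
      · rw [focus_bind_loc_of_ne hl', focus, focus_bind_loc_of_ne hl', focus_bind_loc_of_ne hl',
          Finmap.lookup_insert_of_ne _ hl', Finmap.lookup_insert_of_ne _ hl']
        exact ⟨rfl, rfl, rfl⟩

end OrdBorrow

theorem mainTheorem2 {P : Type*} [OrdBorrow.OPM P]
    (M M' : OrdBorrow.Expr P) (H H' : OrdBorrow.Heap P) (C : OrdBorrow.Ctx P)
    (T : OrdBorrow.Ty P) (e : OrdBorrow.Eff)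
    (hC : C.IsRuntime)
    (hstep : OrdBorrow.Step M H M' H')
    (hM : OrdBorrow.Typing C M T e)
    (hH : C.TypesHeap H) :
    ∃ C' : OrdBorrow.Ctx P,
      C'.IsRuntime ∧ OrdBorrow.Typing C' M' T e ∧ C'.TypesHeap H' := by
  cases hstep with
  | exp E H h =>
    obtain ⟨G, Δ, S, e', hsub, hE⟩ := hM.exists_holeTyping E hC
    have hrt := hsub.isRuntime hC
    have hΔ := (OrdBorrow.CtxPat.isRuntime_fill.1 hrt).2
    -- The heap does not change and `C ≲ G.fill Δ`, so monotonicity of heap typing suffices.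
    exact ⟨G.fill Δ, hrt, hE.replace _ Δ hΔ (hE.typing.beta hΔ h), hH.mono hC hsub⟩
  | cfg E h =>
    obtain ⟨G, Δ, S, e', hsub, hE⟩ := hM.exists_holeTyping E hC
    have hrt := hsub.isRuntime hC
    obtain ⟨Δ', hΔ', hM', hH'⟩ := h.preservation hE.typing hrt (fun he => (hE.lead he).2)
      (hH.mono hC hsub)
    exact ⟨G.fill Δ', OrdBorrow.CtxPat.isRuntime_fill_of_fill hrt hΔ', hE.replace _ Δ' hΔ' hM', hH'⟩
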